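/- Let $n\ge 0$ and $m\ge 1$ be integers, let $H$ be a complex Hilbert space and let $T=(T_1,\dots,T_n)\in L(H)^n$ be a tuple of commuting bounded operators. Write $T:H^n\to H$, $(h_i)_i\mapsto\sum_i T_ih_i$, for the induced row operator (with $H^n$ the Hilbert space direct sum), $T^*:H\to H^n$, $h\mapsto (T_i^*h)_i$, for its adjoint, and $W(T)=H\ominus\sum_i T_iH$ for the wandering subspace of $T$, with orthogonal projection $P_{W(T)}$ onto it. For $z\in\mathbb C^n$ let $Z:H^n\to H$, $(h_i)_i\mapsto\sum_i z_ih_i$. Assume that $T$ is regular at $z=0$, i.e. there is $\epsilon>0$ such that for every $z\in\mathbb C^n$ with Euclidean norm $\|z\|<\epsilon$ the space $(T-Z)H^n\subset H$ is closed and $H=(T-Z)H^n\oplus W(T)$ as an algebraic direct sum. (In particular $\mathrm{Im}\,T$ is closed, hence $T^*T:\mathrm{Im}\,T^*\to\mathrm{Im}\,T^*$ is invertible; denote its inverse by $(T^*T)^{-1}$.) Assume moreover that $$(T^*T)^{-1}=(\oplus\Delta_T)|_{\mathrm{Im}\,T^*},\qquad \Delta_T=\sum_{j=0}^{m-1}(-1)^j\binom{m}{j+1}\sigma_T^j(1_H),\qquad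 \sigma_T(X)=\sum_{i=1}^nT_iXT_i^*,$$ where $\oplus\Delta_T\in L(H^n)$ acts as $(h_i)_i\mapsto(\Delta_Th_i)_i$. Let $L_1,\dots,L_n\in L(H)$ be the components of the column operator $L=(T^*T)^{-1}T^*\in L(H,H^n)$ and put $L^\alpha=L_1^{\alpha_1}\cdots L_n^{\alpha_n}$ and $\gamma_\alpha=|\alpha|!/\alpha!$ for $\alpha\in\mathbb N^n$. Let $[W(T)]$ be the smallest closed linear subspace of $H$ which contains $W(T)$ and is invariant under $T_1,\dots,T_n$, let $\mathbb B\subset\mathbb C^n$ be the open Euclidean unit ball, and let $H_m(\mathbb B,W(T))$ be the $W(T)$-valued functional Hilbert space on $\mathbb B$ with reproducing kernel $K(z,w)=(1-\langle z,w\rangle)^{-m}\,1_{W(T)}$. Then there is a unitary operator $U:[W(T)]\to H_m(\mathbb B,W(T))$ such that $$(Ux)(z)=\sum_{\alpha\in\mathbb N^n}\gamma_\alpha\,(P_{W(T)}L^\alpha x)\,z^\alpha\qquad(x\in[W(T)],\ z\in\mathbb B),$$ the family on the right being summable in $W(T)$, and $U$ intertwines $T|_{[W(T)]}$ with the tuple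 $M_z=(M_{z_1},\dots,M_{z_n})$ of bounded multiplication operators $M_{z_i}f=z_if$ on $H_m(\mathbb B,W(T))$ componentwise: $U(T_i|_{[W(T)]})=M_{z_i}U$ for $i=1,\dots,n$. -/

import Mathlib

open scoped ComplexConjugate

noncomputable section

namespace BergmanShift

open ContinuousLinearMap (adjoint)

/-! ### Operators with closed range -/

section ClosedRange

variable {E F : Type*} [NormedAddCommGroup E] [InnerProductSpace ℂ E] [CompleteSpace E]
  [NormedAddCommGroup F] [InnerProductSpace ℂ F] [CompleteSpace F]

/-- If `S` has closed range, then the range of the adjoint of `S` is the orthogonal complement of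
the kernel of `S`. -/
theorem range_adjoint_eq (S : E →L[ℂ] F) (hS : IsClosed (S.range : Set F)) :
    (adjoint S).range = S.kerᗮ := by
  apply le_antisymm
  · rw [S.orthogonal_ker]
    exact Submodule.le_topologicalClosure _
  · intro x hx
    have : CompleteSpace S.range := hS.completeSpace_coe
    let G : S.kerᗮ →L[ℂ] S.range := S.rangeRestrict.comp S.kerᗮ.subtypeL
    have hGapp : ∀ y, ((G y : S.range) : F) = S y := fun y => rfl
    have hker : IsClosed (S.ker : Set E) := S.isClosed_ker
    have : CompleteSpace S.ker := hker.completeSpace_coe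
    have hdec : ∀ y : E, S (S.kerᗮ.starProjection y) = S y := by
      intro y
      have h1 : y - S.kerᗮ.starProjection y ∈ S.ker := by
        have := S.kerᗮ.sub_starProjection_mem_orthogonal y
        rwa [Submodule.orthogonal_orthogonal] at this
      have h2 : S (y - S.kerᗮ.starProjection y) = 0 := h1
      rw [map_sub, sub_eq_zero] at h2
      exact h2.symm
    have hinj : G.ker = ⊥ := by
      rw [Submodule.eq_bot_iff]
      intro y hy
      have h1 : S y = 0 := by
        have : G y = 0 := hy
        rw [← hGapp, this]; rfl
      have h2 : (y : E) ∈ S.ker := h1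
      have h3 := Submodule.inner_right_of_mem_orthogonal h2 y.2
      exact Subtype.ext (inner_self_eq_zero.mp h3)
    have hsurj : G.range = ⊤ := by
      rw [Submodule.eq_top_iff']
      rintro ⟨_, y, rfl⟩
      refine ⟨⟨S.kerᗮ.starProjection y, Submodule.starProjection_apply_mem _ _⟩, ?_⟩
      exact Subtype.ext (hdec y)
    let e := ContinuousLinearEquiv.ofBijective G hinj hsurj
    have he : ∀ y, e.symm (G y) = y := fun y => e.symm_apply_apply y
    let R : S.range →L[ℂ] S.kerᗮ := e.symm
    refine ⟨((adjoint R ⟨x, hx⟩ : S.range) : F), ?_⟩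
    refine ext_inner_right ℂ fun y => ?_
    have hx0 : ∀ y : E, inner ℂ x y = inner ℂ x (S.kerᗮ.starProjection y) := by
      intro y
      have h1 := S.kerᗮ.sub_starProjection_mem_orthogonal y
      have h2 := Submodule.inner_right_of_mem_orthogonal hx h1
      rw [inner_sub_right, sub_eq_zero] at h2
      exact h2
    have h3 : S y =
        ((G ⟨S.kerᗮ.starProjection y, Submodule.starProjection_apply_mem _ _⟩ : S.range) : F) :=
      (hdec y).symm
    change inner ℂ (adjoint S _) y = _
    rw [ContinuousLinearMap.adjoint_inner_left, h3, ← Submodule.coe_inner,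
      ContinuousLinearMap.adjoint_inner_left, hx0]
    change inner ℂ _ (e.symm _) = _
    rw [he]
    rfl

/-- The operator `S* S : Im S* → Im S*`. -/
def gramOn (S : E →L[ℂ] F) : (adjoint S).range →L[ℂ] (adjoint S).range :=
  (adjoint S ∘L S).restrict (p := (adjoint S).range) (q := (adjoint S).range) fun x _ => ⟨S x, rfl⟩

theorem gramOn_ker (S : E →L[ℂ] F) : (gramOn S).ker = ⊥ := by
  rw [Submodule.eq_bot_iff]
  rintro ⟨_, h, rfl⟩ hy
  have h1 : adjoint S (S (adjoint S h)) = 0 := congrArg Subtype.val (show gramOn S _ = 0 from hy)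
  have h2 : S (adjoint S h) = 0 := by
    rw [← inner_self_eq_zero (𝕜 := ℂ), ← ContinuousLinearMap.adjoint_inner_left, h1,
      inner_zero_left]
  apply Subtype.ext
  change adjoint S h = 0
  rw [← inner_self_eq_zero (𝕜 := ℂ), ContinuousLinearMap.adjoint_inner_left, h2, inner_zero_right]

theorem gramOn_range (S : E →L[ℂ] F) (hS : IsClosed (S.range : Set F)) :
    (gramOn S).range = ⊤ := by
  rw [Submodule.eq_top_iff']
  rintro ⟨_, h, rfl⟩
  have : CompleteSpace S.range := hS.completeSpace_coe
  have : CompleteSpace S.ker := S.isClosed_ker.completeSpace_coe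
  obtain ⟨x, hx⟩ : ∃ x, S x = S.range.starProjection h := S.range.starProjection_apply_mem h
  have h1 : adjoint S (h - S.range.starProjection h) = 0 := by
    have := S.range.sub_starProjection_mem_orthogonal h
    rw [S.orthogonal_range] at this
    exact this
  have h2 : S.kerᗮ.starProjection x ∈ (adjoint S).range := by
    rw [range_adjoint_eq S hS]
    exact Submodule.starProjection_apply_mem _ _
  have h3 : x - S.kerᗮ.starProjection x ∈ S.ker := by
    have := S.kerᗮ.sub_starProjection_mem_orthogonal x
    rwa [Submodule.orthogonal_orthogonal] at this
  have h4 : S (x - S.kerᗮ.starProjection x) = 0 := h3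
  refine ⟨⟨_, h2⟩, Subtype.ext ?_⟩
  change adjoint S (S (S.kerᗮ.starProjection x)) = adjoint S h
  rw [map_sub, sub_eq_zero] at h1 h4
  rw [← h4, hx, h1]

/-- The inverse `(S* S)⁻¹ : Im S* → Im S*` of `S* S : Im S* → Im S*`, for `S` with closed range. -/
def gramInv (S : E →L[ℂ] F) (hS : IsClosed (S.range : Set F)) :
    (adjoint S).range →L[ℂ] (adjoint S).range :=
  haveI : CompleteSpace (adjoint S).range := by
    rw [range_adjoint_eq S hS]; infer_instance
  ((ContinuousLinearEquiv.ofBijective (gramOn S) (gramOn_ker S) (gramOn_range S hS)).symm :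
    (adjoint S).range →L[ℂ] (adjoint S).range)

theorem gramInv_gramOn (S : E →L[ℂ] F) (hS : IsClosed (S.range : Set F)) (y : (adjoint S).range) :
    gramInv S hS (gramOn S y) = y := by
  have : CompleteSpace (adjoint S).range := by
    rw [range_adjoint_eq S hS]; infer_instance
  exact (ContinuousLinearEquiv.ofBijective (gramOn S) (gramOn_ker S)
    (gramOn_range S hS)).symm_apply_apply y

theorem gramOn_gramInv (S : E →L[ℂ] F) (hS : IsClosed (S.range : Set F)) (y : (adjoint S).range) :
    gramOn S (gramInv S hS y) = y := by
  have : CompleteSpace (adjoint S).range := by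
    rw [range_adjoint_eq S hS]; infer_instance
  exact (ContinuousLinearEquiv.ofBijective (gramOn S) (gramOn_ker S)
    (gramOn_range S hS)).apply_symm_apply y

end ClosedRange

/-! ### Operator tuples -/

section Tuples

variable {H : Type*} [NormedAddCommGroup H] [InnerProductSpace ℂ H] {n : ℕ}

/-- The Hilbert space direct sum `H^n`. -/
abbrev HPow (n : ℕ) (H : Type*) [NormedAddCommGroup H] : Type _ := PiLp 2 (fun _ : Fin n => H)

/-- The row operator `H^n → H`, `(h_i) ↦ ∑ i, T_i h_i`, of a tuple `T`. -/
def rowOp (T : Fin n → H →L[ℂ] H) : HPow n H →L[ℂ] H :=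
  ∑ i, T i ∘L PiLp.proj 2 (fun _ : Fin n => H) i

/-- The row operator `Z : H^n → H`, `(h_i) ↦ ∑ i, z_i h_i`, of `z ∈ ℂ^n`. -/
def scalarRow (H : Type*) [NormedAddCommGroup H] [InnerProductSpace ℂ H]
    (z : EuclideanSpace ℂ (Fin n)) : HPow n H →L[ℂ] H :=
  rowOp fun i => z i • (1 : H →L[ℂ] H)

/-- The direct sum `⊕ A` of `n` copies of `A`. -/
def diagOp (n : ℕ) (A : H →L[ℂ] H) : HPow n H →L[ℂ] HPow n H :=
  ((PiLp.continuousLinearEquiv 2 ℂ (fun _ : Fin n => H)).symm :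
      (Fin n → H) →L[ℂ] HPow n H) ∘L
    ContinuousLinearMap.pi fun i => A ∘L PiLp.proj 2 (fun _ : Fin n => H) i

/-- The wandering subspace `W(T)`, the orthogonal complement of `∑ i, T_i H`. -/
def wandering (T : Fin n → H →L[ℂ] H) : Submodule ℂ H := (rowOp T).rangeᗮ

instance instCompleteSpaceWandering [CompleteSpace H] (T : Fin n → H →L[ℂ] H) :
    CompleteSpace (wandering T) :=
  inferInstanceAs (CompleteSpace ((rowOp T).rangeᗮ : Submodule ℂ H))

/-- Regularity at `z = 0`: for all `z` near `0`, the space `(T - Z)H^n` is closed and `H` is the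
algebraic direct sum of `(T - Z)H^n` and `W(T)`. -/
def RegularAtZero (T : Fin n → H →L[ℂ] H) : Prop :=
  ∃ ε : ℝ, 0 < ε ∧ ∀ z : EuclideanSpace ℂ (Fin n), ‖z‖ < ε →
    IsClosed ((rowOp T - scalarRow H z).range : Set H) ∧
      IsCompl (rowOp T - scalarRow H z).range (wandering T)

theorem RegularAtZero.isClosed_range {T : Fin n → H →L[ℂ] H} (hT : RegularAtZero T) :
    IsClosed ((rowOp T).range : Set H) := by
  obtain ⟨ε, hε, h⟩ := hT
  have h0 : scalarRow H (0 : EuclideanSpace ℂ (Fin n)) = 0 := by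
    ext x
    simp [scalarRow, rowOp]
  have := (h 0 (by simpa using hε)).1
  rwa [h0, sub_zero] at this

/-- The smallest closed linear subspace of `H` that contains `M` and is invariant under all the
operators `T_i`. -/
def invariantHull (T : Fin n → H →L[ℂ] H) (M : Set H) : Submodule ℂ H :=
  sInf {N | IsClosed (N : Set H) ∧ (∀ i, ∀ x ∈ N, T i x ∈ N) ∧ M ⊆ N}

theorem apply_mem_invariantHull (T : Fin n → H →L[ℂ] H) (M : Set H) (i : Fin n) :
    ∀ x ∈ invariantHull T M, T i x ∈ invariantHull T M := by
  intro x hx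
  simp only [invariantHull, Submodule.mem_sInf] at hx ⊢
  exact fun N hN => hN.2.1 i x (hx N hN)

/-- The restriction of `T_i` to the invariant subspace generated by `M`. -/
def restrictHull (T : Fin n → H →L[ℂ] H) (M : Set H) (i : Fin n) :
    invariantHull T M →L[ℂ] invariantHull T M :=
  (T i).restrict (apply_mem_invariantHull T M i)

variable [CompleteSpace H]

/-- `σ_T(X) = ∑ i, T_i X T_i*`. -/
def sigmaOp (T : Fin n → H →L[ℂ] H) (X : H →L[ℂ] H) : H →L[ℂ] H :=
  ∑ i, T i * X * adjoint (T i)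

/-- `Δ_T = ∑_{j < m} (-1)^j binom(m, j + 1) σ_T^j(1)`. -/
def defectOp (m : ℕ) (T : Fin n → H →L[ℂ] H) : H →L[ℂ] H :=
  ∑ j ∈ Finset.range m, ((-1 : ℂ) ^ j * (m.choose (j + 1) : ℂ)) • (sigmaOp T)^[j] 1

/-- The column operator `L = (T* T)⁻¹ T* : H → H^n` of a tuple whose row operator has closed
range. -/
def columnL (T : Fin n → H →L[ℂ] H) (hT : IsClosed ((rowOp T).range : Set H)) :
    H →L[ℂ] HPow n H :=
  (adjoint (rowOp T)).range.subtypeL ∘L gramInv (rowOp T) hT ∘L (adjoint (rowOp T)).rangeRestrict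

/-- The components `L_i` of the column operator `L`. -/
def compL (T : Fin n → H →L[ℂ] H) (hT : IsClosed ((rowOp T).range : Set H)) (i : Fin n) :
    H →L[ℂ] H :=
  PiLp.proj 2 (fun _ : Fin n => H) i ∘L columnL T hT

end Tuples

/-- `S^α = S_1^{α_1} ⋯ S_n^{α_n}`. -/
def tuplePow {H : Type*} [NormedAddCommGroup H] [InnerProductSpace ℂ H] {n : ℕ}
    (S : Fin n → H →L[ℂ] H) (α : Fin n → ℕ) : H →L[ℂ] H :=
  (List.ofFn fun i => S i ^ α i).prod

/-- `γ_α = |α|! / α!`. -/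
def gammaCoeff {n : ℕ} (α : Fin n → ℕ) : ℂ :=
  ((∑ i, α i).factorial : ℂ) / ∏ i, ((α i).factorial : ℂ)

/-- The open Euclidean unit ball of `ℂ^n`. -/
abbrev UnitBall (n : ℕ) : Type := Metric.ball (0 : EuclideanSpace ℂ (Fin n)) 1

/-! ### The spaces `H_m(𝔹, E)` -/

section Kernel

variable {X : Type*} (E : Type*) [NormedAddCommGroup E] [InnerProductSpace ℂ E]

/-- Positivity of the operator-valued kernel `κ(x, y) 1_E`. -/
def IsPosKernel (κ : X → X → ℂ) : Prop :=
  (∀ x y, conj (κ y x) = κ x y) ∧ ∀ (s : Finset X) (v : X → E),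
    0 ≤ (∑ x ∈ s, ∑ y ∈ s, inner ℂ (κ y x • v x) (v y)).re

variable {E}

theorem IsPosKernel.one : IsPosKernel E (fun _ _ : X => (1 : ℂ)) := by
  refine ⟨fun _ _ => by simp, fun s v => ?_⟩
  have : ∑ x ∈ s, ∑ y ∈ s, inner ℂ ((1 : ℂ) • v x) (v y)
      = inner ℂ (∑ x ∈ s, v x) (∑ x ∈ s, v x) := by
    simp only [sum_inner, inner_sum, one_smul]
    exact Finset.sum_comm
  rw [this]
  exact inner_self_nonneg (𝕜 := ℂ)

theorem IsPosKernel.zero : IsPosKernel E (fun _ _ : X => (0 : ℂ)) :=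
  ⟨fun _ _ => by simp, fun s v => by simp⟩

theorem IsPosKernel.add {κ κ' : X → X → ℂ} (h : IsPosKernel E κ) (h' : IsPosKernel E κ') :
    IsPosKernel E (fun x y => κ x y + κ' x y) := by
  refine ⟨fun x y => by rw [map_add, h.1, h'.1], fun s v => ?_⟩
  simp only [add_smul, inner_add_left, Finset.sum_add_distrib, Complex.add_re]
  exact add_nonneg (h.2 s v) (h'.2 s v)

theorem IsPosKernel.sum {ι : Type*} (t : Finset ι) {κ : ι → X → X → ℂ}
    (h : ∀ i ∈ t, IsPosKernel E (κ i)) : IsPosKernel E (fun x y => ∑ i ∈ t, κ i x y) := by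
  classical
  induction t using Finset.induction_on with
  | empty => simpa using IsPosKernel.zero
  | insert a t ha ih =>
    simp only [Finset.sum_insert ha]
    exact (h a (by simp)).add (ih fun i hi => h i (by simp [hi]))

theorem IsPosKernel.conjugate {κ : X → X → ℂ} (h : IsPosKernel E κ) (φ : X → ℂ) :
    IsPosKernel E (fun x y => φ x * conj (φ y) * κ x y) := by
  refine ⟨fun x y => ?_, fun s v => ?_⟩
  · simp only [map_mul, Complex.conj_conj, h.1]
    ring
  · have := h.2 s fun x => conj (φ x) • v x
    refine this.trans_eq ?_
    congr 1
    refine Finset.sum_congr rfl fun x _ => Finset.sum_congr rfl fun y _ => ?_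
    simp only [inner_smul_left, inner_smul_right, map_mul, Complex.conj_conj]
    ring

theorem IsPosKernel.limit {κ : ℕ → X → X → ℂ} {κ' : X → X → ℂ} (h : ∀ k, IsPosKernel E (κ k))
    (hlim : ∀ x y, Filter.Tendsto (fun k => κ k x y) Filter.atTop (nhds (κ' x y))) :
    IsPosKernel E κ' := by
  refine ⟨fun x y => ?_, fun s v => ?_⟩
  · refine tendsto_nhds_unique
      ((Complex.continuous_conj.tendsto _).comp (hlim y x)) ?_
    have : (⇑(starRingEnd ℂ) ∘ fun k => κ k y x) = fun k => κ k x y :=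
      funext fun k => (h k).1 x y
    rw [this]
    exact hlim x y
  · refine ge_of_tendsto' (f := fun k => (∑ x ∈ s, ∑ y ∈ s, inner ℂ (κ k y x • v x) (v y)).re)
      (x := Filter.atTop) ?_ fun k => (h k).2 s v
    refine (Complex.continuous_re.tendsto _).comp ?_
    refine tendsto_finsetSum _ fun x _ => tendsto_finsetSum _ fun y _ => ?_
    exact ((hlim y x).smul_const (v x)).inner tendsto_const_nhds

variable [CompleteSpace E]

open scoped ComplexOrder in
theorem IsPosKernel.posSemidef {κ : X → X → ℂ} (h : IsPosKernel E κ) :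
    (Matrix.of fun x y => κ x y • (1 : E →L[ℂ] E)).PosSemidef := by
  refine (RKHS.posSemidef_tfae.out 0 2).mpr (And.intro ?_ fun v => ?_)
  · ext x y e
    simp only [Matrix.conjTranspose_apply, Matrix.of_apply, star_smul, star_one]
    exact congrArg (fun c : ℂ => c • e) (h.1 x y)
  · exact h.2 v.support v

end Kernel

section Space

variable (n m : ℕ) (E : Type*) [NormedAddCommGroup E] [InnerProductSpace ℂ E]

theorem norm_inner_lt_one (z w : UnitBall n) :
    ‖inner ℂ (w : EuclideanSpace ℂ (Fin n)) z‖ < 1 := by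
  have hz : ‖(z : EuclideanSpace ℂ (Fin n))‖ < 1 := mem_ball_zero_iff.mp z.2
  have hw : ‖(w : EuclideanSpace ℂ (Fin n))‖ < 1 := mem_ball_zero_iff.mp w.2
  calc _ ≤ ‖(w : EuclideanSpace ℂ (Fin n))‖ * ‖(z : EuclideanSpace ℂ (Fin n))‖ :=
        norm_inner_le_norm _ _
    _ < 1 := by nlinarith [norm_nonneg (z : EuclideanSpace ℂ (Fin n)),
        norm_nonneg (w : EuclideanSpace ℂ (Fin n))]

/-- The kernel `(1 - ⟨z, w⟩)^{-m}` on the unit ball, where `⟨z, w⟩ = ∑ i, z_i conj(w_i)`; Mathlib's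
inner product is conjugate linear in its first argument. -/
def scalarKernel (z w : UnitBall n) : ℂ :=
  ((1 - inner ℂ (w : EuclideanSpace ℂ (Fin n)) (z : EuclideanSpace ℂ (Fin n))) ^ m)⁻¹

/-- The operator-valued kernel `K_m^E(z, w) = (1 - ⟨z, w⟩)^{-m} 1_E` on the unit ball. -/
def kernelM : Matrix (UnitBall n) (UnitBall n) (E →L[ℂ] E) :=
  Matrix.of fun z w => scalarKernel n m z w • (1 : E →L[ℂ] E)

variable {n m E}

theorem inner_eq_sum (z w : UnitBall n) :
    inner ℂ (w : EuclideanSpace ℂ (Fin n)) (z : EuclideanSpace ℂ (Fin n)) =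
      ∑ i, z.1 i * conj (w.1 i) := by
  simp [PiLp.inner_apply]

theorem IsPosKernel.inner_mul {κ : UnitBall n → UnitBall n → ℂ} (h : IsPosKernel E κ) :
    IsPosKernel E (fun z w : UnitBall n => inner ℂ (w : EuclideanSpace ℂ (Fin n)) z.1 * κ z w) := by
  simp only [inner_eq_sum, Finset.sum_mul]
  exact IsPosKernel.sum _ fun i _ => h.conjugate fun z => z.1 i

theorem IsPosKernel.inner_pow_mul {κ : UnitBall n → UnitBall n → ℂ} (h : IsPosKernel E κ)
    (k : ℕ) :
    IsPosKernel E (fun z w : UnitBall n => inner ℂ (w : EuclideanSpace ℂ (Fin n)) z.1 ^ k * κ z w) := by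
  induction k with
  | zero => simpa using h
  | succ k ih =>
    have := ih.inner_mul
    simpa only [pow_succ', mul_assoc] using this

theorem isPosKernel_scalarKernel (n m : ℕ) : IsPosKernel E (scalarKernel n m) := by
  induction m with
  | zero =>
    have : scalarKernel n 0 = fun _ _ => 1 := by
      ext z w; simp [scalarKernel]
    rw [this]
    exact IsPosKernel.one
  | succ m ih =>
    refine IsPosKernel.limit (κ := fun N (z w : UnitBall n) => ∑ k ∈ Finset.range N,
      inner ℂ (w : EuclideanSpace ℂ (Fin n)) z.1 ^ k * scalarKernel n m z w)
      (fun N => IsPosKernel.sum _ fun k _ => ih.inner_pow_mul k) fun z w => ?_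
    have h1 := (hasSum_geometric_of_norm_lt_one (norm_inner_lt_one n z w)).mul_right
      (scalarKernel n m z w)
    convert h1.tendsto_sum_nat using 2
    simp only [scalarKernel, pow_succ', mul_inv]

theorem isPosKernel_mul (n m : ℕ) (hm : 1 ≤ m) (i : Fin n) :
    IsPosKernel E (fun z w : UnitBall n => (1 - z.1 i * conj (w.1 i)) * scalarKernel n m z w) := by
  obtain ⟨m, rfl⟩ : ∃ k, m = k + 1 := ⟨m - 1, by omega⟩
  have h := (isPosKernel_scalarKernel (E := E) n m).add
    (IsPosKernel.sum (Finset.univ.erase i)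
      fun j _ => (isPosKernel_scalarKernel (E := E) n (m + 1)).conjugate fun z => z.1 j)
  convert h using 3 with z w
  have hne : (1 - inner ℂ (w : EuclideanSpace ℂ (Fin n)) z.1) ≠ 0 := by
    intro h0
    have h1 := norm_inner_lt_one n z w
    rw [← sub_eq_zero.mp h0] at h1
    simp at h1
  have h1 : scalarKernel n m z w =
      (1 - inner ℂ (w : EuclideanSpace ℂ (Fin n)) z.1) * scalarKernel n (m + 1) z w := by
    simp only [scalarKernel, pow_succ', mul_inv]
    rw [mul_inv_cancel_left₀ hne]
  rw [h1, ← Finset.sum_mul, inner_eq_sum, ← Finset.add_sum_erase _ _ (Finset.mem_univ i)]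
  ring

variable [CompleteSpace E]

open scoped ComplexOrder in
instance instFactKernelM (n m : ℕ) : Fact (kernelM n m E).PosSemidef :=
  ⟨(isPosKernel_scalarKernel n m).posSemidef⟩

/-- The `E`-valued functional Hilbert space `H_m(𝔹, E)` on the unit ball with reproducing kernel
`(1 - ⟨z, w⟩)^{-m} 1_E`. Its elements `f` are evaluated at points `z` of the ball as `f z`. -/
abbrev HSpace (n m : ℕ) (E : Type*) [NormedAddCommGroup E] [InnerProductSpace ℂ E]
    [CompleteSpace E] : Type _ := RKHS.OfKernel (kernelM n m E)

theorem kernel_hSpace : RKHS.kernel (HSpace n m E) = kernelM n m E :=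
  RKHS.OfKernel.kernel_ofKernel

/-- The map `v ↦ ∑_w K(·, w) v_w` on finitely supported families. -/
def kerLin (n m : ℕ) (E : Type*) [NormedAddCommGroup E] [InnerProductSpace ℂ E]
    [CompleteSpace E] : (UnitBall n →₀ E) →ₗ[ℂ] HSpace n m E :=
  Finsupp.lsum ℂ fun w => (RKHS.kerFun (HSpace n m E) w : E →ₗ[ℂ] HSpace n m E)

/-- The map `v ↦ ∑_w conj(w_i) K(·, w) v_w` on finitely supported families. -/
def kerLinMul (n m : ℕ) (E : Type*) [NormedAddCommGroup E] [InnerProductSpace ℂ E]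
    [CompleteSpace E] (i : Fin n) : (UnitBall n →₀ E) →ₗ[ℂ] HSpace n m E :=
  Finsupp.lsum ℂ fun w =>
    ((conj (w.1 i) • RKHS.kerFun (HSpace n m E) w : E →L[ℂ] HSpace n m E) :
      E →ₗ[ℂ] HSpace n m E)

/-- The multiplication operator `M_{z_i} : f ↦ z_i f` on `H_m(𝔹, E)` for `m ≥ 1`, built as the
adjoint of the bounded operator with `K(·, w) e ↦ conj(w_i) K(·, w) e`; see `mulCoord_apply`. -/
def mulCoord (n m : ℕ) (E : Type*) [NormedAddCommGroup E] [InnerProductSpace ℂ E]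
    [CompleteSpace E] (i : Fin n) : HSpace n m E →L[ℂ] HSpace n m E :=
  adjoint ((kerLinMul n m E i).extendOfNorm (kerLin n m E))

theorem denseRange_kerLin : DenseRange (kerLin n m E) := by
  have h := RKHS.kerFun_dense (HSpace n m E)
  have h2 : Submodule.span ℂ {RKHS.kerFun (HSpace n m E) x v | (x) (v)} ≤
      LinearMap.range (kerLin n m E) := by
    rw [Submodule.span_le]
    rintro _ ⟨x, v, rfl⟩
    exact ⟨Finsupp.single x v, by simp [kerLin]⟩
  have h3 : (LinearMap.range (kerLin n m E)).topologicalClosure = ⊤ :=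
    top_le_iff.mp (h ▸ Submodule.topologicalClosure_mono h2)
  have h4 := Submodule.dense_iff_topologicalClosure_eq_top.mpr h3
  rwa [LinearMap.coe_range] at h4

theorem norm_kerLinMul_le (hm : 1 ≤ m) (i : Fin n) (v : UnitBall n →₀ E) :
    ‖kerLinMul n m E i v‖ ≤ 1 * ‖kerLin n m E v‖ := by
  rw [one_mul, ← sq_le_sq₀ (norm_nonneg _) (norm_nonneg _), ← sub_nonneg,
    ← inner_self_eq_norm_sq (𝕜 := ℂ), ← inner_self_eq_norm_sq (𝕜 := ℂ), ← map_sub]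
  have h := (isPosKernel_mul (E := E) n m hm i).2 v.support v
  have e1 : kerLinMul n m E i v = ∑ x ∈ v.support,
      conj (x.1 i) • RKHS.kerFun (HSpace n m E) x (v x) := rfl
  have e2 : kerLin n m E v = ∑ x ∈ v.support, RKHS.kerFun (HSpace n m E) x (v x) := rfl
  have hk : ∀ x y, inner ℂ (RKHS.kerFun (HSpace n m E) x (v x))
      (RKHS.kerFun (HSpace n m E) y (v y)) = inner ℂ (scalarKernel n m y x • v x) (v y) := by
    intro x y
    rw [← RKHS.kernel_inner, kernel_hSpace]
    rfl
  have key : inner ℂ (kerLin n m E v) (kerLin n m E v) -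
      inner ℂ (kerLinMul n m E i v) (kerLinMul n m E i v) =
      ∑ x ∈ v.support, ∑ y ∈ v.support,
        inner ℂ (((1 - y.1 i * conj (x.1 i)) * scalarKernel n m y x) • v x) (v y) := by
    rw [e1, e2]
    simp only [sum_inner]
    rw [← Finset.sum_sub_distrib]
    refine Finset.sum_congr rfl fun x _ => ?_
    simp only [inner_sum]
    rw [← Finset.sum_sub_distrib]
    refine Finset.sum_congr rfl fun y _ => ?_
    rw [inner_smul_left, inner_smul_right, hk, mul_smul, inner_smul_left _ _ (1 - _)]
    simp only [map_sub, map_mul, map_one, Complex.conj_conj]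
    ring
  rw [key]
  exact h

theorem mulCoord_apply (hm : 1 ≤ m) (i : Fin n) (f : HSpace n m E) (z : UnitBall n) :
    mulCoord n m E i f z = z.1 i • f z := by
  refine ext_inner_left ℂ fun e => ?_
  have h := LinearMap.extendOfNorm_eq (f := kerLinMul n m E i) denseRange_kerLin
    ⟨1, norm_kerLinMul_le hm i⟩ (Finsupp.single z e)
  have e1 : kerLinMul n m E i (Finsupp.single z e) =
      conj (z.1 i) • RKHS.kerFun (HSpace n m E) z e := by
    simp only [kerLinMul, Finsupp.lsum_single]
    rfl
  have e2 : kerLin n m E (Finsupp.single z e) = RKHS.kerFun (HSpace n m E) z e := by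
    simp only [kerLin, Finsupp.lsum_single]
    rfl
  rw [e1, e2] at h
  rw [← RKHS.kerFun_inner, mulCoord, ContinuousLinearMap.adjoint_inner_right]
  rw [h, inner_smul_left, inner_smul_right, Complex.conj_conj, RKHS.kerFun_inner]

end Space

end BergmanShift

end

noncomputable section

namespace BergmanShift

open Finset Filter Topology

open ContinuousLinearMap (adjoint)

/-! ### Power series and homogeneous polynomials -/

/-! Everything rests on how `T_i` and the adjoints `L_i*` act on vectors generated by `w ∈ W(T)`.
Let `P` be the projection onto `W(T)`, `M = ∑ z_j L_j`, and `x = (1 - M)⁻¹ (T_i - z_i) y` with `z`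
small. Since `TL = 1 - P`, the vector `P x` lies in `(T - Z)H^n ∩ W(T)`, so it vanishes by
regularity. Replacing `z` by `t z` and comparing powers of `t` gives `P M^(k+1) T_i = z_i P M^k`.
The adjoint form, with `A = ∑ z_j L_j*`, is `T_i* A^(k+1) w = z_i A^k w` (`adjoint_apply_pow_succ`).

The hypothesis on `(T* T)⁻¹` says `L_i* = T_i Δ_T`. Let `b_k` be the coefficients of `(1 - x)^(-m)`.
The backward shift relation gives `σ_T^j(1) A^k w = (∑ z_i T_i)^j A^(k-j) w` for `j ≤ k`, and the
signed binomials in `Δ_T` are those of `(1 - x)^m`. Hence `(1 - x)^m (1 - x)^(-m) = 1` drives an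
induction to `A^k w = b_k (∑ z_i T_i)^k w` (`DefectIdentity.pow_apply`).

Comparing coefficients of `z^α` turns this into statements about single monomials. The spaces `T^α
W(T)` are mutually orthogonal with `γ_α b_|α| ‖T^α w‖² = ‖w‖²`
(`DefectIdentity.inner_tuplePow_apply`), and `(L^α)* w = b_|α| T^α w`
(`DefectIdentity.adjoint_tuplePow_compL_apply`). So `[W(T)]` is an `ℓ²` sum of copies of `W(T)` with
weights `γ_α b_|α|`. These are also the Taylor coefficients of the kernel, so `H_m(𝔹, W(T))` is the
same `ℓ²` sum (`coeffEquiv`). Composing the two identifications gives `U`. -/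

theorem eq_zero_of_eventually_hasSum_pow_smul {E : Type*} [NormedAddCommGroup E]
    [NormedSpace ℂ E] {a : ℕ → E}
    (h : ∀ᶠ t : ℂ in 𝓝 0, HasSum (fun k => t ^ k • a k) 0) (k : ℕ) : a k = 0 := by
  let p : FormalMultilinearSeries ℂ ℂ E := fun k =>
    ContinuousMultilinearMap.mkPiRing ℂ (Fin k) (a k)
  have hp : ∀ k, p.coeff k = a k := fun k => by
    simp [p, FormalMultilinearSeries.coeff]
  have h0 : HasFPowerSeriesAt (0 : ℂ → E) p 0 := by
    rw [hasFPowerSeriesAt_iff]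
    simpa [hp] using h
  rw [← hp, h0.eq_zero]
  rfl

/-- A polynomial over the infinite field `ℂ` that vanishes at every point is the zero polynomial.
This is the device that passes from identities in `∑ z_i T_i` to single monomials `T^α`. -/
theorem eq_zero_of_forall_sum_monomial {n k : ℕ} {v : (Fin n → ℕ) → ℂ}
    (h : ∀ z : Fin n → ℂ, ∑ α ∈ piAntidiag univ k, (∏ i, z i ^ α i) * v α = 0)
    {α : Fin n → ℕ} (hα : ∑ i, α i = k) : v α = 0 := by
  let p : MvPolynomial (Fin n) ℂ := ∑ α ∈ piAntidiag univ k,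
    MvPolynomial.monomial (Finsupp.equivFunOnFinite.symm α) (v α)
  have hp : p = 0 := by
    refine MvPolynomial.funext fun z => ?_
    rw [map_zero, ← h z, map_sum]
    refine sum_congr rfl fun α _ => ?_
    rw [MvPolynomial.eval_monomial, mul_comm, Finsupp.prod_fintype _ _ (by simp)]
    simp
  have h1 := congrArg (MvPolynomial.coeff (Finsupp.equivFunOnFinite.symm α)) hp
  rw [MvPolynomial.coeff_sum, MvPolynomial.coeff_zero] at h1
  simp only [MvPolynomial.coeff_monomial, EmbeddingLike.apply_eq_iff_eq] at h1
  rwa [sum_ite_eq', if_pos (by simp [hα])] at h1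

theorem eq_zero_of_forall_sum_monomial_smul {E : Type*} [NormedAddCommGroup E]
    [InnerProductSpace ℂ E] {n k : ℕ} {v : (Fin n → ℕ) → E}
    (h : ∀ z : Fin n → ℂ, ∑ α ∈ piAntidiag univ k, (∏ i, z i ^ α i) • v α = 0)
    {α : Fin n → ℕ} (hα : ∑ i, α i = k) : v α = 0 := by
  refine ext_inner_left ℂ fun e => ?_
  rw [inner_zero_right]
  refine eq_zero_of_forall_sum_monomial (v := fun α => inner ℂ e (v α)) (fun z => ?_) hα
  have := congrArg (inner ℂ e) (h z)
  simpa only [inner_sum, inner_smul_right, inner_zero_right] using this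

/-! ### Multi-indices and summation by degree. -/

theorem prod_pow_add_single {A : Type*} [CommMonoid A] {n : ℕ} (z : Fin n → A) (α : Fin n → ℕ)
    (i : Fin n) :
    ∏ j, z j ^ (α + Pi.single i 1 : Fin n → ℕ) j = z i * ∏ j, z j ^ α j := by
  simp only [Pi.add_apply, pow_add, prod_mul_distrib]
  rw [mul_comm]
  congr 1
  rw [prod_eq_single i (fun j _ hj => by simp [hj]) (by simp)]
  simp

/-- Multi-indices, sorted by their degree. -/
def sigmaPiAntidiagEquiv (n : ℕ) :
    (Σ k : ℕ, {α : Fin n → ℕ // α ∈ piAntidiag univ k}) ≃ (Fin n → ℕ) where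
  toFun x := x.2.1
  invFun α := ⟨∑ i, α i, α, by simp⟩
  left_inv := by
    rintro ⟨k, α, h⟩
    obtain rfl : ∑ i, α i = k := (mem_piAntidiag.mp h).1
    rfl
  right_inv _ := rfl

theorem hasSum_sum_piAntidiag {E : Type*} [NormedAddCommGroup E] {n : ℕ}
    {f : (Fin n → ℕ) → E} {s : E} (h : HasSum f s) :
    HasSum (fun k => ∑ α ∈ piAntidiag univ k, f α) s := by
  refine HasSum.sigma ((sigmaPiAntidiagEquiv n).hasSum_iff.mpr h) fun k => ?_
  exact (piAntidiag univ k).hasSum f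

theorem summable_of_summable_sum_piAntidiag {n : ℕ} {f : (Fin n → ℕ) → ℝ} (hf : ∀ α, 0 ≤ f α)
    (h : Summable fun k => ∑ α ∈ piAntidiag univ k, f α) : Summable f := by
  rw [← (sigmaPiAntidiagEquiv n).summable_iff]
  refine (summable_sigma_of_nonneg fun _ => hf _).mpr ⟨fun k => ((piAntidiag univ k).hasSum f).summable, ?_⟩
  refine h.congr fun k => ?_
  exact ((piAntidiag univ k).hasSum f).tsum_eq.symm

/-! ### The coefficients of the kernel -/

/-- The coefficient of `x ^ k` in `(1 - x) ^ (-m)`, for `m ≥ 1`. -/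
def binCoeff (m k : ℕ) : ℕ := (k + (m - 1)).choose (m - 1)

/-- The coefficient of `u ^ α` in `(1 - ∑ i, u i) ^ (-m)`, for `m ≥ 1`. -/
def kernelWeight {n : ℕ} (m : ℕ) (α : Fin n → ℕ) : ℕ :=
  Nat.multinomial univ α * binCoeff m (∑ i, α i)

theorem binCoeff_pos (m k : ℕ) : 0 < binCoeff m k := Nat.choose_pos (by omega)

theorem binCoeff_zero (m : ℕ) : binCoeff m 0 = 1 := by simp [binCoeff]

theorem kernelWeight_pos {n : ℕ} (m : ℕ) (α : Fin n → ℕ) : 0 < kernelWeight m α :=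
  Nat.mul_pos (Nat.multinomial_pos _ _) (binCoeff_pos _ _)

theorem kernelWeight_zero (n m : ℕ) : kernelWeight m (0 : Fin n → ℕ) = 1 := by
  simp [kernelWeight, binCoeff_zero, Nat.multinomial]

theorem gammaCoeff_eq_multinomial {n : ℕ} (α : Fin n → ℕ) :
    gammaCoeff α = Nat.multinomial univ α := by
  have h := Nat.multinomial_spec univ α
  have hne : (∏ i, ((α i).factorial : ℂ)) ≠ 0 :=
    prod_ne_zero_iff.mpr fun i _ => by exact_mod_cast Nat.factorial_ne_zero _
  rw [gammaCoeff, div_eq_iff hne, ← h]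
  push_cast
  ring

theorem hasSum_binCoeff {𝕜 : Type*} [NormedDivisionRing 𝕜] [HasSummableGeomSeries 𝕜] {m : ℕ}
    (hm : 1 ≤ m) {r : 𝕜} (hr : ‖r‖ < 1) :
    HasSum (fun k => (binCoeff m k : 𝕜) * r ^ k) (1 / (1 - r) ^ m) := by
  have := hasSum_choose_mul_geometric_of_norm_lt_one (m - 1) hr
  rwa [Nat.sub_add_cancel hm] at this

/-- This is the coefficient of `x^(k+1)` in `(1 - x)^m (1 - x)^(-m) = 1`, with the term of index `0`
in `(1 - x)^m` moved to the other side. The remaining factors are, up to sign, the coefficients of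
`Δ_T`. -/
theorem binCoeff_recurrence {m : ℕ} (hm : 1 ≤ m) (k : ℕ) :
    ∑ j ∈ range (k + 1), ((-1 : ℂ) ^ j * (m.choose (j + 1) : ℂ)) * binCoeff m (k - j) =
      binCoeff m (k + 1) := by
  obtain ⟨p, rfl⟩ : ∃ p, m = p + 1 := ⟨m - 1, by omega⟩
  have h := PowerSeries.mk_add_choose_mul_one_sub_pow_eq_one ℂ p
  have hc : ∀ j, PowerSeries.coeff j ((1 - PowerSeries.X : PowerSeries ℂ) ^ (p + 1)) =
      (-1) ^ j * ((p + 1).choose j : ℂ) := by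
    intro j
    have : ((1 - PowerSeries.X : PowerSeries ℂ) ^ (p + 1)) =
        (((1 - Polynomial.X) ^ (p + 1) : Polynomial ℂ) : PowerSeries ℂ) := by simp
    rw [this, Polynomial.coeff_coe, sub_eq_neg_add, add_pow, Polynomial.finsetSum_coeff]
    simp only [one_pow, mul_one, neg_pow (Polynomial.X : Polynomial ℂ)]
    have e : ∀ i, (-1 : Polynomial ℂ) ^ i * Polynomial.X ^ i * ((p + 1).choose i : Polynomial ℂ) =
        Polynomial.C ((-1) ^ i * ((p + 1).choose i : ℂ)) * Polynomial.X ^ i := by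
      intro i
      simp only [map_mul, map_pow, map_neg, map_one, map_natCast]
      ring
    simp only [e, Polynomial.coeff_C_mul_X_pow]
    rw [sum_ite_eq]
    split_ifs with hj
    · rfl
    · rw [Nat.choose_eq_zero_of_lt (by simpa using hj)]
      simp
  have h1 := congrArg (PowerSeries.coeff (k + 1)) h
  rw [mul_comm, PowerSeries.coeff_mul, Nat.sum_antidiagonal_eq_sum_range_succ_mk,
    sum_range_succ', PowerSeries.coeff_one, if_neg (by omega)] at h1
  simp only [hc, PowerSeries.coeff_mk] at h1
  have h2 : ∀ j, ((-1 : ℂ) ^ j * ((p + 1).choose (j + 1) : ℂ)) * binCoeff (p + 1) (k - j) =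
      -((-1) ^ (j + 1) * ((p + 1).choose (j + 1) : ℂ) * ((p + (k + 1 - (j + 1))).choose p : ℂ)) := by
    intro j
    rw [binCoeff, Nat.add_sub_add_right, Nat.sub_zero, Nat.add_comm (k - j), Nat.add_sub_add_right, pow_succ]
    ring
  simp only [h2]
  rw [sum_neg_distrib, binCoeff, Nat.add_sub_cancel]
  rw [pow_zero, Nat.choose_zero_right, Nat.cast_one, one_mul, one_mul, Nat.sub_zero, Nat.add_comm p (k + 1)] at h1
  linear_combination -h1

theorem sum_kernelWeight {𝕜 : Type*} [Field 𝕜] {n : ℕ} (m k : ℕ) (u : Fin n → 𝕜) :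
    ∑ α ∈ piAntidiag univ k, (kernelWeight m α : 𝕜) * ∏ i, u i ^ α i =
      binCoeff m k * (∑ i, u i) ^ k := by
  rw [sum_pow_eq_sum_piAntidiag, mul_sum]
  refine sum_congr rfl fun α hα => ?_
  rw [kernelWeight, (mem_piAntidiag.mp hα).1]
  push_cast
  ring

theorem summable_kernelWeight {n m : ℕ} (hm : 1 ≤ m) {r : Fin n → ℝ} (hr : ∀ i, 0 ≤ r i)
    (hr1 : ∑ i, r i < 1) : Summable fun α : Fin n → ℕ => (kernelWeight m α : ℝ) * ∏ i, r i ^ α i := by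
  refine summable_of_summable_sum_piAntidiag
    (fun α => mul_nonneg (Nat.cast_nonneg _) (prod_nonneg fun i _ => pow_nonneg (hr i) _)) ?_
  simp only [sum_kernelWeight]
  refine (hasSum_binCoeff hm ?_).summable
  rwa [Real.norm_of_nonneg (sum_nonneg fun i _ => hr i)]

/-- Absolute convergence allows summation by degree, where the multinomial theorem leaves the
one-variable binomial series in `∑ i, u i`. -/
theorem hasSum_kernelWeight {n m : ℕ} (hm : 1 ≤ m) {u : Fin n → ℂ} (hu : ∑ i, ‖u i‖ < 1) :
    HasSum (fun α : Fin n → ℕ => (kernelWeight m α : ℂ) * ∏ i, u i ^ α i)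
      ((1 - ∑ i, u i) ^ m)⁻¹ := by
  have h1 : Summable fun α : Fin n → ℕ => (kernelWeight m α : ℂ) * ∏ i, u i ^ α i := by
    refine Summable.of_norm ((summable_kernelWeight hm (fun i => norm_nonneg (u i)) hu).congr ?_)
    intro α
    simp
  have h2 := hasSum_sum_piAntidiag h1.hasSum
  simp only [sum_kernelWeight] at h2
  have h3 := hasSum_binCoeff (𝕜 := ℂ) hm ((norm_sum_le _ _).trans_lt hu)
  rw [one_div] at h3
  exact (h2.unique h3) ▸ h1.hasSum

theorem sum_norm_sq_lt_one {n : ℕ} (z : UnitBall n) : ∑ i, ‖z.1 i‖ ^ 2 < 1 := by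
  rw [← EuclideanSpace.norm_sq_eq]
  have := mem_ball_zero_iff.mp z.2
  nlinarith [norm_nonneg z.1]

theorem sum_norm_mul_lt_one {n : ℕ} (z w : UnitBall n) : ∑ i, ‖z.1 i * conj (w.1 i)‖ < 1 := by
  calc ∑ i, ‖z.1 i * conj (w.1 i)‖ ≤ ∑ i, (‖z.1 i‖ ^ 2 + ‖w.1 i‖ ^ 2) / 2 := by
        refine sum_le_sum fun i _ => ?_
        rw [norm_mul, RCLike.norm_conj]
        nlinarith [sq_nonneg (‖z.1 i‖ - ‖w.1 i‖)]
    _ = (∑ i, ‖z.1 i‖ ^ 2 + ∑ i, ‖w.1 i‖ ^ 2) / 2 := by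
        rw [← sum_div, sum_add_distrib]
    _ < 1 := by linarith [sum_norm_sq_lt_one z, sum_norm_sq_lt_one w]

theorem hasSum_scalarKernel {n m : ℕ} (hm : 1 ≤ m) (z w : UnitBall n) :
    HasSum (fun α : Fin n → ℕ => (kernelWeight m α : ℂ) * ∏ i, (z.1 i * conj (w.1 i)) ^ α i)
      (scalarKernel n m z w) := by
  rw [scalarKernel, inner_eq_sum]
  exact hasSum_kernelWeight hm (sum_norm_mul_lt_one z w)

/-! ### The spaces `H_m(𝔹, E)` as spaces of sequences of coefficients -/

section Coefficients

variable {n m : ℕ} {E : Type*} [NormedAddCommGroup E] [InnerProductSpace ℂ E]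

/-- The Hilbert space of square summable families in `E`, indexed by multi-indices. -/
abbrev CoeffSpace (n : ℕ) (E : Type*) [NormedAddCommGroup E] : Type _ :=
  lp (fun _ : Fin n → ℕ => E) 2

/-- The normalized monomials. -/
def normMonomial (m : ℕ) (z : UnitBall n) (α : Fin n → ℕ) : ℂ :=
  (Real.sqrt (kernelWeight m α) : ℂ) * ∏ i, z.1 i ^ α i

theorem conj_normMonomial_mul (m : ℕ) (z w : UnitBall n) (α : Fin n → ℕ) :
    normMonomial m z α * conj (normMonomial m w α) =
      kernelWeight m α * ∏ i, (z.1 i * conj (w.1 i)) ^ α i := by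
  have h : (Real.sqrt (kernelWeight m α) : ℂ) * (Real.sqrt (kernelWeight m α) : ℂ) =
      kernelWeight m α := by
    rw [← Complex.ofReal_mul, Real.mul_self_sqrt (Nat.cast_nonneg _), Complex.ofReal_natCast]
  simp only [normMonomial, map_mul, map_prod, map_pow, Complex.conj_ofReal, mul_pow,
    prod_mul_distrib]
  linear_combination ((∏ i, z.1 i ^ α i) * ∏ i, conj (w.1 i) ^ α i) * h

theorem summable_norm_normMonomial_sq (hm : 1 ≤ m) (z : UnitBall n) :
    Summable fun α => ‖normMonomial m z α‖ ^ 2 := by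
  refine (summable_kernelWeight (m := m) hm (fun i => sq_nonneg ‖z.1 i‖)
    (sum_norm_sq_lt_one z)).congr fun α => ?_
  rw [normMonomial, norm_mul, mul_pow, norm_prod, ← prod_pow, Complex.norm_real,
    Real.norm_of_nonneg (Real.sqrt_nonneg _), Real.sq_sqrt (Nat.cast_nonneg _)]
  simp only [norm_pow, pow_right_comm]

theorem CoeffSpace.summable_norm_sq {E : Type*} [NormedAddCommGroup E] (a : CoeffSpace n E) : Summable fun α => ‖a α‖ ^ 2 := by
  simpa using (lp.memℓp a).summable (by simp)

theorem summable_normMonomial_smul [CompleteSpace E] (hm : 1 ≤ m) (z : UnitBall n)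
    (a : CoeffSpace n E) : Summable fun α => normMonomial m z α • a α := by
  refine Summable.of_norm_bounded
    ((summable_norm_normMonomial_sq hm z).add a.summable_norm_sq) fun α => ?_
  rw [norm_smul]
  nlinarith [sq_nonneg (‖normMonomial m z α‖ - ‖a α‖), norm_nonneg (normMonomial m z α),
    norm_nonneg (a α)]

/-- The family of coefficients of the function `K(·, z) e`. -/
def kernelCoeff (hm : 1 ≤ m) (z : UnitBall n) : E →ₗ[ℂ] CoeffSpace n E where
  toFun e := ⟨fun α => conj (normMonomial m z α) • e, by
    refine memℓp_gen ?_
    refine ((summable_norm_normMonomial_sq hm z).mul_right (‖e‖ ^ 2)).congr fun α => ?_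
    simp [norm_smul, mul_pow]⟩
  map_add' e f := by
    ext α
    exact smul_add _ e f
  map_smul' c e := by
    ext α
    exact smul_comm _ c e

theorem kernelCoeff_apply (hm : 1 ≤ m) (z : UnitBall n) (e : E) (α : Fin n → ℕ) :
    kernelCoeff hm z e α = conj (normMonomial m z α) • e := rfl

theorem inner_kernelCoeff (hm : 1 ≤ m) (z : UnitBall n) (e : E) (a : CoeffSpace n E) :
    HasSum (fun α => normMonomial m z α * inner ℂ e (a α)) (inner ℂ (kernelCoeff hm z e) a) := by
  have := lp.hasSum_inner (𝕜 := ℂ) (kernelCoeff hm z e) a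
  simpa only [kernelCoeff_apply, inner_smul_left, Complex.conj_conj] using this

theorem inner_kernelCoeff_kernelCoeff (hm : 1 ≤ m) (z w : UnitBall n) (e f : E) :
    inner ℂ (kernelCoeff hm z e) (kernelCoeff hm w f) = scalarKernel n m z w * inner ℂ e f := by
  refine (inner_kernelCoeff hm z e _).unique ?_
  refine ((hasSum_scalarKernel hm z w).mul_right (inner ℂ e f)).congr_fun fun α => ?_
  rw [kernelCoeff_apply, inner_smul_right, ← mul_assoc, conj_normMonomial_mul]

/-- The pairings are the values of a power series on the ball. On each complex line `t ↦ t z` its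
homogeneous parts vanish, and then so does every coefficient, because the weights are nonzero. -/
theorem eq_zero_of_inner_kernelCoeff (hm : 1 ≤ m) {a : CoeffSpace n E}
    (h : ∀ z e, inner ℂ (kernelCoeff hm z e) a = 0) : a = 0 := by
  ext α
  refine ext_inner_left ℂ fun e => ?_
  rw [lp.coeFn_zero, Pi.zero_apply, inner_zero_right]
  have hz : ∀ z : Fin n → ℂ, ∑ β ∈ piAntidiag univ (∑ i, α i), (∏ i, z i ^ β i) *
      ((Real.sqrt (kernelWeight m β) : ℂ) * inner ℂ e (a β)) = 0 := by
    intro z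
    refine eq_zero_of_eventually_hasSum_pow_smul (a := fun k => ∑ β ∈ piAntidiag univ k,
      (∏ i, z i ^ β i) * ((Real.sqrt (kernelWeight m β) : ℂ) * inner ℂ e (a β))) ?_ _
    have hc : Tendsto (fun t : ℂ => t • WithLp.toLp 2 z) (𝓝 0) (𝓝 0) := by
      have : Continuous fun t : ℂ => t • WithLp.toLp 2 z := by fun_prop
      simpa using this.tendsto 0
    filter_upwards [hc.eventually (Metric.ball_mem_nhds (0 : EuclideanSpace ℂ (Fin n)) one_pos)]
      with t ht
    have h1 := inner_kernelCoeff hm (⟨_, ht⟩ : UnitBall n) e a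
    rw [h] at h1
    convert hasSum_sum_piAntidiag h1 using 2 with k
    rw [smul_sum]
    refine sum_congr rfl fun β hβ => ?_
    simp only [normMonomial, PiLp.smul_apply, smul_eq_mul, mul_pow, prod_mul_distrib]
    rw [prod_pow_eq_pow_sum, (mem_piAntidiag.mp hβ).1]
    ring
  have h1 := eq_zero_of_forall_sum_monomial hz (α := α) rfl
  refine (mul_eq_zero.mp h1).resolve_left ?_
  rw [← ne_eq, Complex.ofReal_ne_zero, Real.sqrt_ne_zero (Nat.cast_nonneg _)]
  exact_mod_cast (kernelWeight_pos m α).ne'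

variable [CompleteSpace E]

/-- The map `v ↦ ∑_w K(·, w) v_w` on finitely supported families, in terms of coefficients. -/
def kernelCoeffLin (hm : 1 ≤ m) : (UnitBall n →₀ E) →ₗ[ℂ] CoeffSpace n E :=
  Finsupp.lsum ℂ fun w => kernelCoeff hm w

theorem denseRange_kernelCoeffLin (hm : 1 ≤ m) :
    DenseRange (kernelCoeffLin hm : (UnitBall n →₀ E) →ₗ[ℂ] CoeffSpace n E) := by
  rw [DenseRange, ← LinearMap.coe_range, Submodule.dense_iff_topologicalClosure_eq_top,
    Submodule.topologicalClosure_eq_top_iff, Submodule.eq_bot_iff]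
  intro a ha
  refine eq_zero_of_inner_kernelCoeff hm fun z e => ?_
  refine ha _ ⟨Finsupp.single z e, ?_⟩
  simp [kernelCoeffLin]

/-- The two families of kernel vectors have the same Gram matrix. With both spans dense, this is
what extends to the isometry `coeffEquiv`. -/
theorem norm_kernelCoeffLin (hm : 1 ≤ m) (v : UnitBall n →₀ E) :
    ‖kernelCoeffLin hm v‖ = ‖kerLin n m E v‖ := by
  rw [← sq_eq_sq₀ (norm_nonneg _) (norm_nonneg _),
    ← inner_self_eq_norm_sq (𝕜 := ℂ), ← inner_self_eq_norm_sq (𝕜 := ℂ)]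
  have e1 : kernelCoeffLin hm v = ∑ x ∈ v.support, kernelCoeff hm x (v x) := rfl
  have e2 : kerLin n m E v = ∑ x ∈ v.support, RKHS.kerFun (HSpace n m E) x (v x) := rfl
  have hk : ∀ x y, inner ℂ (RKHS.kerFun (HSpace n m E) x (v x))
      (RKHS.kerFun (HSpace n m E) y (v y)) = scalarKernel n m x y * inner ℂ (v x) (v y) := by
    intro x y
    rw [← RKHS.kernel_inner, kernel_hSpace]
    change inner ℂ (scalarKernel n m y x • v x) (v y) = _
    rw [inner_smul_left, (isPosKernel_scalarKernel (E := E) n m).1]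
  rw [e1, e2]
  simp only [sum_inner, inner_sum, hk, inner_kernelCoeff_kernelCoeff]

/-- The isometric isomorphism of `H_m(𝔹, E)` with the space of families of normalized
coefficients. -/
def coeffEquiv (hm : 1 ≤ m) : HSpace n m E ≃ₗᵢ[ℂ] CoeffSpace n E :=
  (LinearEquiv.refl ℂ (UnitBall n →₀ E)).extendOfIsometry (kerLin n m E) (kernelCoeffLin hm)
    denseRange_kerLin (denseRange_kernelCoeffLin hm) (norm_kernelCoeffLin hm)

theorem coeffEquiv_kerFun (hm : 1 ≤ m) (z : UnitBall n) (e : E) :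
    coeffEquiv hm (RKHS.kerFun (HSpace n m E) z e) = kernelCoeff hm z e := by
  have := LinearEquiv.extendOfIsometry_eq (LinearEquiv.refl ℂ (UnitBall n →₀ E)) (kerLin n m E)
    (kernelCoeffLin hm) denseRange_kerLin (denseRange_kernelCoeffLin hm) (norm_kernelCoeffLin hm)
    (Finsupp.single z e)
  simpa [kerLin, kernelCoeffLin, coeffEquiv] using this

/-- Evaluation at `z` paired with `e` is the inner product with `K(·, z) e`, which the isometry
carries to `kernelCoeff hm z e`. -/
theorem hasSum_coeffEquiv_symm (hm : 1 ≤ m) (a : CoeffSpace n E) (z : UnitBall n) :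
    HasSum (fun α => normMonomial m z α • a α) ((coeffEquiv hm).symm a z) := by
  have hs := (summable_normMonomial_smul hm z a).hasSum
  convert hs
  refine ext_inner_left ℂ fun e => ?_
  have h1 := hs.mapL (innerSL ℂ e)
  simp only [innerSL_apply_apply, inner_smul_right] at h1
  refine HasSum.unique ?_ h1
  rw [← RKHS.kerFun_inner, ← LinearIsometryEquiv.inner_map_map (coeffEquiv hm), coeffEquiv_kerFun,
    LinearIsometryEquiv.apply_symm_apply]
  exact inner_kernelCoeff hm z e a

end Coefficients

section Operators

variable {H : Type*} [NormedAddCommGroup H] [InnerProductSpace ℂ H] {n m : ℕ}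
  {T : Fin n → H →L[ℂ] H}

/-! ### Powers of commuting tuples -/

/-- The algebra generated by the `T_i` is commutative, so finite products and the multinomial
theorem are available there and can be transported back to operators. -/
theorem exists_commRing_of_commute (hcomm : ∀ i j, Commute (T i) (T j)) :
    ∃ (A : Subalgebra ℂ (H →L[ℂ] H)) (_ : IsMulCommutative A) (t : Fin n → A),
      ∀ i, (t i : H →L[ℂ] H) = T i := by
  refine ⟨Algebra.adjoin ℂ (Set.range T), Algebra.isMulCommutative_adjoin ℂ ?_,
    fun i => ⟨T i, Algebra.subset_adjoin ⟨i, rfl⟩⟩, fun i => rfl⟩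
  rintro _ ⟨i, rfl⟩ _ ⟨j, rfl⟩
  exact hcomm i j

open scoped IsMulCommutative in
theorem tuplePow_coe (A : Subalgebra ℂ (H →L[ℂ] H)) [IsMulCommutative A] (t : Fin n → A)
    (α : Fin n → ℕ) :
    tuplePow (fun i => (t i : H →L[ℂ] H)) α = ((∏ i, t i ^ α i : A) : H →L[ℂ] H) := by
  rw [tuplePow, ← List.prod_ofFn, ← A.coe_val, map_list_prod, List.map_ofFn]
  rfl

theorem tuplePow_zero (T : Fin n → H →L[ℂ] H) : tuplePow T 0 = 1 := by
  simp [tuplePow]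

open scoped IsMulCommutative in
theorem tuplePow_add_single (hcomm : ∀ i j, Commute (T i) (T j)) (α : Fin n → ℕ) (i : Fin n) :
    tuplePow T (α + Pi.single i 1) = T i * tuplePow T α := by
  obtain ⟨A, _, t, ht⟩ := exists_commRing_of_commute hcomm
  obtain rfl : (fun i => (t i : H →L[ℂ] H)) = T := funext ht
  rw [tuplePow_coe, tuplePow_coe, ← A.coe_mul]
  congr 1
  exact prod_pow_add_single t α i

open scoped IsMulCommutative in
theorem sum_smul_pow (hcomm : ∀ i j, Commute (T i) (T j)) (z : Fin n → ℂ) (k : ℕ) :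
    (∑ i, z i • T i) ^ k = ∑ α ∈ piAntidiag univ k,
      ((∏ i, z i ^ α i) * (Nat.multinomial univ α : ℂ)) • tuplePow T α := by
  obtain ⟨A, _, t, ht⟩ := exists_commRing_of_commute hcomm
  obtain rfl : (fun i => (t i : H →L[ℂ] H)) = T := funext ht
  have h := congrArg A.val (sum_pow_eq_sum_piAntidiag univ (fun i => z i • t i) k)
  simp only [map_pow, map_sum, map_smul, A.coe_val] at h
  rw [h]
  refine sum_congr rfl fun α _ => ?_
  rw [tuplePow_coe, ← A.coe_smul]
  congr 1
  simp only [smul_pow, prod_smul]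
  rw [mul_smul, Nat.cast_smul_eq_nsmul, nsmul_eq_mul, mul_smul_comm]

theorem binCoeff_smul_pow_apply (hcomm : ∀ i j, Commute (T i) (T j)) (m : ℕ) (z : Fin n → ℂ)
    (k : ℕ) (w : H) :
    (binCoeff m k : ℂ) • ((∑ i, z i • T i) ^ k) w = ∑ α ∈ piAntidiag univ k,
      (∏ i, z i ^ α i) • (kernelWeight m α : ℂ) • tuplePow T α w := by
  rw [sum_smul_pow hcomm, _root_.sum_apply, smul_sum]
  refine sum_congr rfl fun α hα => ?_
  rw [smul_apply, smul_smul, smul_smul, kernelWeight, (mem_piAntidiag.mp hα).1]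
  congr 1
  push_cast
  ring

/-- If `S` and `S'` raise degrees by `δ` and `δ'`, up to the factors `binCoeff`, so does `S' S`. -/
theorem comp_tuplePow_apply {w : H} {S S' : H →L[ℂ] H} {δ δ' : Fin n → ℕ}
    (h : ∀ β, (binCoeff m (∑ j, β j) : ℂ) • S (tuplePow T β w) =
      (binCoeff m (∑ j, (β + δ) j) : ℂ) • tuplePow T (β + δ) w)
    (h' : ∀ β, (binCoeff m (∑ j, β j) : ℂ) • S' (tuplePow T β w) =
      (binCoeff m (∑ j, (β + δ') j) : ℂ) • tuplePow T (β + δ') w) (β : Fin n → ℕ) :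
    (binCoeff m (∑ j, β j) : ℂ) • (S' * S) (tuplePow T β w) =
      (binCoeff m (∑ j, (β + (δ + δ')) j) : ℂ) • tuplePow T (β + (δ + δ')) w := by
  rw [mul_apply_eq_comp, ← map_smul, h, map_smul, h', add_assoc]

/-! ### The row operator and the left inverse -/

theorem rowOp_apply (T : Fin n → H →L[ℂ] H) (h : HPow n H) : rowOp T h = ∑ i, T i (h i) := by
  simp [rowOp]

theorem rowOp_sub_scalarRow_apply (T : Fin n → H →L[ℂ] H) (z : EuclideanSpace ℂ (Fin n))
    (h : HPow n H) : (rowOp T - scalarRow H z) h = ∑ i, (T i (h i) - z i • h i) := by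
  simp [scalarRow, rowOp_apply, sum_sub_distrib]

theorem apply_mem_range_rowOp (T : Fin n → H →L[ℂ] H) (i : Fin n) (x : H) :
    T i x ∈ (rowOp T).range := by
  classical
  refine ⟨WithLp.toLp 2 (Pi.single i x), ?_⟩
  change rowOp T _ = _
  rw [rowOp_apply, sum_eq_single i (fun j _ hj => by simp [hj]) (by simp)]
  simp

variable [CompleteSpace H]

theorem adjoint_rowOp_apply (T : Fin n → H →L[ℂ] H) (x : H) (i : Fin n) :
    adjoint (rowOp T) x i = adjoint (T i) x := by
  classical
  refine ext_inner_right ℂ fun y => ?_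
  have h := ContinuousLinearMap.adjoint_inner_left (rowOp T) (WithLp.toLp 2 (Pi.single i y)) x
  rw [rowOp_apply, PiLp.inner_apply, sum_eq_single i (fun j _ hj => by simp [hj]) (by simp),
    sum_eq_single i (fun j _ hj => by simp [hj]) (by simp)] at h
  simpa [ContinuousLinearMap.adjoint_inner_left] using h

theorem adjoint_apply_of_mem_wandering {w : H} (hw : w ∈ wandering T) (i : Fin n) :
    adjoint (T i) w = 0 := by
  refine ext_inner_right ℂ fun y => ?_
  rw [ContinuousLinearMap.adjoint_inner_left, inner_zero_left]
  exact Submodule.inner_left_of_mem_orthogonal (apply_mem_range_rowOp T i y) hw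

theorem rowOp_columnL (hT : IsClosed ((rowOp T).range : Set H)) (x : H) :
    rowOp T (columnL T hT x) = x - (wandering T).starProjection x := by
  have h1 : adjoint (rowOp T) (rowOp T (columnL T hT x)) = adjoint (rowOp T) x :=
    congrArg Subtype.val (gramOn_gramInv (rowOp T) hT ((adjoint (rowOp T)).rangeRestrict x))
  have h2 : x - rowOp T (columnL T hT x) ∈ wandering T := by
    rw [wandering, ContinuousLinearMap.orthogonal_range]
    change adjoint (rowOp T) _ = 0
    rw [map_sub, h1, sub_self]
  have h3 : rowOp T (columnL T hT x) ∈ (wandering T)ᗮ :=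
    Submodule.le_orthogonal_orthogonal _ ⟨_, rfl⟩
  have h4 := Submodule.eq_starProjection_of_mem_orthogonal h2 (by rwa [sub_sub_cancel])
  rw [h4, sub_sub_cancel]

theorem sum_apply_compL (hT : IsClosed ((rowOp T).range : Set H)) (x : H) :
    ∑ i, T i (compL T hT i x) = x - (wandering T).starProjection x := by
  rw [← rowOp_columnL hT, rowOp_apply]
  rfl

/-- The relation `TL = 1 - P` gives `(T - Z) L x = x - P x - ∑ z_j L_j x`. With the assumption on
`x` this exhibits `P x` as an element of `(T - Z)H^n`, which meets `W(T)` only in `0`. -/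
theorem starProjection_inverse_eq_zero (hT : IsClosed ((rowOp T).range : Set H))
    {z : EuclideanSpace ℂ (Fin n)}
    (hz : IsCompl (rowOp T - scalarRow H z).range (wandering T)) {x y : H} {i : Fin n}
    (hx : x - ∑ j, z j • compL T hT j x = T i y - z i • y) :
    (wandering T).starProjection x = 0 := by
  classical
  have h1 : ∀ h, (rowOp T - scalarRow H z) h ∈ (rowOp T - scalarRow H z).range :=
    fun h => ⟨h, rfl⟩
  have h2 : (rowOp T - scalarRow H z) (columnL T hT x) =
      x - (wandering T).starProjection x - ∑ j, z j • compL T hT j x := by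
    rw [rowOp_sub_scalarRow_apply, sum_sub_distrib, ← sum_apply_compL hT]
    rfl
  have h3 : (rowOp T - scalarRow H z) (WithLp.toLp 2 (Pi.single i y)) = T i y - z i • y := by
    rw [rowOp_sub_scalarRow_apply, sum_eq_single i (fun j _ hj => by simp [hj]) (by simp)]
    simp
  refine Submodule.disjoint_def.mp hz.disjoint _ ?_ (Submodule.starProjection_apply_mem _ _)
  have h4 : (wandering T).starProjection x = (rowOp T - scalarRow H z)
      (WithLp.toLp 2 (Pi.single i y) - columnL T hT x) := by
    rw [map_sub, h2, h3, ← hx]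
    abel
  rw [h4]
  exact h1 _

/-- These are the Taylor coefficients in `t` of `P (1 - t M)⁻¹ (T_i - t z_i) y = 0`, with the
inverse expanded in a Neumann series. -/
theorem starProjection_pow_succ_apply (hreg : RegularAtZero T) (z : Fin n → ℂ) (k : ℕ)
    (i : Fin n) (y : H) :
    (wandering T).starProjection (((∑ j, z j • compL T hreg.isClosed_range j) ^ (k + 1)) (T i y)) =
      z i • (wandering T).starProjection
        (((∑ j, z j • compL T hreg.isClosed_range j) ^ k) y) := by
  set hT := hreg.isClosed_range
  set M : H →L[ℂ] H := ∑ j, z j • compL T hT j with hM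
  set P := (wandering T).starProjection
  obtain ⟨ε, hε, hreg⟩ := hreg
  -- `a k` is the coefficient of `t ^ k` in that expansion; the constant one has no contribution
  -- from `z i`, so it is given separately.
  let a : ℕ → H := fun k => Nat.casesOn k (P (T i y))
    fun k => P ((M ^ (k + 1)) (T i y)) - z i • P ((M ^ k) y)
  suffices ∀ᶠ t : ℂ in 𝓝 0, HasSum (fun k => t ^ k • a k) 0 from
    sub_eq_zero.mp (eq_zero_of_eventually_hasSum_pow_smul this (k + 1))
  have hc : ∀ᶠ t : ℂ in 𝓝 0, ‖t • WithLp.toLp 2 z‖ < ε := by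
    have h1 : Continuous fun t : ℂ => ‖t • WithLp.toLp 2 z‖ := by fun_prop
    have h2 := h1.tendsto 0
    rw [zero_smul, norm_zero] at h2
    exact h2.eventually (gt_mem_nhds hε)
  have hd : ∀ᶠ t : ℂ in 𝓝 0, ‖t • M‖ < 1 := by
    have h1 : Continuous fun t : ℂ => ‖t • M‖ := by fun_prop
    have h2 := h1.tendsto 0
    rw [zero_smul, norm_zero] at h2
    exact h2.eventually (gt_mem_nhds one_pos)
  filter_upwards [hc, hd] with t ht htM
  set S : H →L[ℂ] H := ∑' k, (t • M) ^ k with hS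
  have hsum : HasSum (fun k => (t • M) ^ k) S :=
    (summable_geometric_of_norm_lt_one htM).hasSum
  have hinv : (1 - t • M) * S = 1 := mul_neg_geom_series _ htM
  have hP : ∀ x, HasSum (fun k => t ^ k • P ((M ^ k) x)) (P (S x)) := by
    intro x
    have := (hsum.mapL (ContinuousLinearMap.apply ℂ H x)).mapL P
    simpa [smul_pow] using this
  have h0 : P (S (T i y - (t * z i) • y)) = 0 := by
    refine starProjection_inverse_eq_zero hT (hreg _ ht).2 (y := y) (i := i) ?_
    have h1 := congrArg (fun R : H →L[ℂ] H => R (T i y - (t * z i) • y)) hinv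
    simp only [mul_apply_eq_comp, sub_apply,
      one_apply_eq_self, smul_apply] at h1
    have h2 : ∀ x, t • M x = ∑ j, (t • WithLp.toLp 2 z : EuclideanSpace ℂ (Fin n)) j •
        compL T hT j x := by
      intro x
      rw [hM, _root_.sum_apply, smul_sum]
      exact sum_congr rfl fun j _ => smul_smul t (z j) _
    rw [← h2, h1]
    rfl
  have h1 := hP (T i y)
  have h2 := (hP y).const_smul (t * z i)
  rw [map_sub, map_sub, map_smul, map_smul, sub_eq_zero] at h0
  rw [← h0] at h2
  have h3 : HasSum (fun k => t ^ (k + 1) • a (k + 1)) (P (S (T i y)) - P (T i y) - P (S (T i y))) := by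
    have h4 := (hasSum_nat_add_iff' 1).mpr h1
    simp only [range_one, sum_singleton, pow_zero, one_smul, one_apply_eq_self] at h4
    refine (h4.sub h2).congr_fun fun k => ?_
    change t ^ (k + 1) • (_ - _) = _
    rw [smul_sub, smul_smul, smul_smul]
    congr 2
    ring
  have h5 := (hasSum_nat_add_iff (f := fun k => t ^ k • a k) 1).mp h3
  convert h5 using 1
  simp [a]

/-- On the wandering subspace, the adjoint of `T_i` acts on powers of `∑ z_j L_j*` like a
backward shift. -/
theorem adjoint_apply_pow_succ (hreg : RegularAtZero T) (z : Fin n → ℂ) (k : ℕ) (i : Fin n)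
    {w : H} (hw : w ∈ wandering T) :
    adjoint (T i) (((∑ j, z j • adjoint (compL T hreg.isClosed_range j)) ^ (k + 1)) w) =
      z i • ((∑ j, z j • adjoint (compL T hreg.isClosed_range j)) ^ k) w := by
  -- Adjoints conjugate scalars, so the identity for `∑ z_j L_j` is applied at the conjugate point.
  have hA : ∀ k, (∑ j, z j • adjoint (compL T hreg.isClosed_range j)) ^ k =
      adjoint ((∑ j, conj (z j) • compL T hreg.isClosed_range j) ^ k) := by
    intro k
    simp only [← ContinuousLinearMap.star_eq_adjoint, star_pow, star_sum, star_smul]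
    simp
  have hw' : ∀ x, inner ℂ w x = inner ℂ w ((wandering T).starProjection x) := by
    intro x
    rw [← Submodule.inner_starProjection_left_eq_right,
      Submodule.starProjection_eq_self_iff.mpr hw]
  refine ext_inner_right ℂ fun y => ?_
  rw [ContinuousLinearMap.adjoint_inner_left, hA, hA, ContinuousLinearMap.adjoint_inner_left,
    inner_smul_left, ContinuousLinearMap.adjoint_inner_left, hw',
    starProjection_pow_succ_apply hreg, inner_smul_right, ← hw']

end Operators

section Defect

variable {H : Type*} [NormedAddCommGroup H] [InnerProductSpace ℂ H] [CompleteSpace H] {n m : ℕ}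
  {T : Fin n → H →L[ℂ] H}

/-! ### The defect operator on the invariant subspace generated by the wandering subspace -/

theorem sigmaOp_apply (T : Fin n → H →L[ℂ] H) (X : H →L[ℂ] H) (x : H) :
    sigmaOp T X x = ∑ i, T i (X (adjoint (T i) x)) := by
  simp [sigmaOp]

theorem isSelfAdjoint_sigmaOp_iterate (T : Fin n → H →L[ℂ] H) (j : ℕ) :
    IsSelfAdjoint ((sigmaOp T)^[j] 1) := by
  induction j with
  | zero => exact IsSelfAdjoint.one _
  | succ j ih =>
    rw [Function.iterate_succ_apply', IsSelfAdjoint, sigmaOp, star_sum]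
    refine sum_congr rfl fun i _ => ?_
    rw [← ContinuousLinearMap.star_eq_adjoint, star_mul, star_mul, star_star, ih.star_eq, mul_assoc]

theorem isSelfAdjoint_defectOp (m : ℕ) (T : Fin n → H →L[ℂ] H) :
    IsSelfAdjoint (defectOp m T) := by
  rw [IsSelfAdjoint, defectOp, star_sum]
  refine sum_congr rfl fun j _ => ?_
  rw [star_smul, (isSelfAdjoint_sigmaOp_iterate T j).star_eq]
  simp

/-- The identity `(T* T)⁻¹ = (⊕ Δ_T)|_{Im T*}`. -/
def DefectIdentity (m : ℕ) (T : Fin n → H →L[ℂ] H) (hT : IsClosed ((rowOp T).range : Set H)) :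
    Prop :=
  ∀ y : (adjoint (rowOp T)).range,
    (gramInv (rowOp T) hT y : HPow n H) = diagOp n (defectOp m T) (y : HPow n H)

/-- On `Im T*` the inverse acts as `⊕ Δ_T`, so `L_i = Δ_T T_i*`; the adjoint follows since `Δ_T` is
self-adjoint. -/
theorem DefectIdentity.adjoint_compL {hT : IsClosed ((rowOp T).range : Set H)}
    (hid : DefectIdentity m T hT) (i : Fin n) :
    adjoint (compL T hT i) = T i * defectOp m T := by
  have h : compL T hT i = defectOp m T * adjoint (T i) := by
    ext x
    change (gramInv (rowOp T) hT ((adjoint (rowOp T)).rangeRestrict x) : HPow n H) i = _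
    rw [hid]
    change defectOp m T (adjoint (rowOp T) x i) = _
    rw [adjoint_rowOp_apply]
    rfl
  rw [h, ← ContinuousLinearMap.star_eq_adjoint, star_mul, (isSelfAdjoint_defectOp m T).star_eq,
    ContinuousLinearMap.star_eq_adjoint, ContinuousLinearMap.adjoint_adjoint]

/-- Each application of `σ_T` trades one factor `A` for one factor `∑ z_i T_i`. Once the powers of
`A` are used up, `T_i* w = 0` kills the rest. -/
theorem sigmaOp_iterate_apply_pow {w : H} (hw : w ∈ wandering T) {z : Fin n → ℂ} {A : H →L[ℂ] H}
    (hA : ∀ k i, adjoint (T i) ((A ^ (k + 1)) w) = z i • (A ^ k) w) (j k : ℕ) :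
    ((sigmaOp T)^[j] 1) ((A ^ k) w) =
      if j ≤ k then ((∑ i, z i • T i) ^ j) ((A ^ (k - j)) w) else 0 := by
  induction j generalizing k with
  | zero => simp
  | succ j ih =>
    rw [Function.iterate_succ_apply', sigmaOp_apply]
    cases k with
    | zero => simp [adjoint_apply_of_mem_wandering hw]
    | succ k =>
      simp only [hA, map_smul, ih, Nat.add_le_add_iff_right, Nat.add_sub_add_right]
      split_ifs
      · rw [pow_succ', mul_apply_eq_comp, _root_.sum_apply]
        rfl
      · simp

theorem defectOp_apply_pow (hm : 1 ≤ m) {w : H} (hw : w ∈ wandering T) {z : Fin n → ℂ}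
    {A : H →L[ℂ] H} (hA : ∀ k i, adjoint (T i) ((A ^ (k + 1)) w) = z i • (A ^ k) w) {k : ℕ}
    (hk : ∀ l ≤ k, (A ^ l) w = (binCoeff m l : ℂ) • ((∑ i, z i • T i) ^ l) w) :
    defectOp m T ((A ^ k) w) = (binCoeff m (k + 1) : ℂ) • ((∑ i, z i • T i) ^ k) w := by
  rw [defectOp, _root_.sum_apply, ← binCoeff_recurrence hm, sum_smul]
  have h : ∀ j, (((-1 : ℂ) ^ j * (m.choose (j + 1) : ℂ)) • (sigmaOp T)^[j] 1) ((A ^ k) w) =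
      if j < k + 1 then (((-1 : ℂ) ^ j * (m.choose (j + 1) : ℂ)) * binCoeff m (k - j)) •
        ((∑ i, z i • T i) ^ k) w else 0 := by
    intro j
    rw [smul_apply, sigmaOp_iterate_apply_pow hw hA]
    simp only [Nat.lt_succ_iff]
    split_ifs with hj
    · rw [hk _ (Nat.sub_le k j), map_smul, ← mul_apply_eq_comp, ← pow_add, smul_smul,
        Nat.add_sub_cancel' hj]
    · simp
  simp only [h]
  -- Both sums reduce to `j < min m (k + 1)`: on the left the terms with `j > k` are zero, on the
  -- right those with `j ≥ m`, where `m.choose (j + 1) = 0`.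
  rw [← sum_filter, ← sum_filter_of_ne (s := range (k + 1)) (p := fun j => j < m)]
  · refine sum_congr ?_ fun _ _ => rfl
    ext j
    simp [and_comm]
  · intro j _ hj
    by_contra hjm
    rw [Nat.choose_eq_zero_of_lt (by omega)] at hj
    simp at hj

/-- Since `A = (∑ z_j T_j) Δ_T`, one more factor `A` amounts to applying `Δ_T` and then `∑ z_j T_j`.
The induction is strong because `Δ_T` applied to `A^k w` involves all lower powers of `A`. -/
theorem DefectIdentity.pow_apply (hm : 1 ≤ m) (hreg : RegularAtZero T)
    (hid : DefectIdentity m T hreg.isClosed_range) {w : H} (hw : w ∈ wandering T) (z : Fin n → ℂ)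
    (k : ℕ) :
    ((∑ j, z j • adjoint (compL T hreg.isClosed_range j)) ^ k) w =
      (binCoeff m k : ℂ) • ((∑ i, z i • T i) ^ k) w := by
  induction k using Nat.strong_induction_on with
  | _ k ih =>
    cases k with
    | zero => simp [binCoeff_zero]
    | succ k =>
      have h := defectOp_apply_pow hm hw
        (fun k i => adjoint_apply_pow_succ hreg z k i hw) (k := k) fun l hl => ih l (by omega)
      have hA : (∑ j, z j • adjoint (compL T hreg.isClosed_range j)) =
          (∑ j, z j • T j) * defectOp m T := by
        simp only [hid.adjoint_compL, sum_mul, smul_mul_assoc]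
      rw [pow_succ', mul_apply_eq_comp]
      nth_rewrite 1 [hA]
      rw [mul_apply_eq_comp, h, map_smul, ← mul_apply_eq_comp, ← pow_succ']

theorem DefectIdentity.defectOp_pow_apply (hm : 1 ≤ m) (hreg : RegularAtZero T)
    (hid : DefectIdentity m T hreg.isClosed_range) {w : H} (hw : w ∈ wandering T) (z : Fin n → ℂ)
    (k : ℕ) :
    (binCoeff m k : ℂ) • defectOp m T (((∑ i, z i • T i) ^ k) w) =
      (binCoeff m (k + 1) : ℂ) • ((∑ i, z i • T i) ^ k) w := by
  rw [← map_smul, ← hid.pow_apply hm hreg hw]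
  exact defectOp_apply_pow hm hw (fun k i => adjoint_apply_pow_succ hreg z k i hw)
    fun l _ => hid.pow_apply hm hreg hw z l

theorem DefectIdentity.adjoint_pow_apply (hm : 1 ≤ m) (hreg : RegularAtZero T)
    (hid : DefectIdentity m T hreg.isClosed_range) {w : H} (hw : w ∈ wandering T) (z : Fin n → ℂ)
    (k : ℕ) (i : Fin n) :
    (binCoeff m (k + 1) : ℂ) • adjoint (T i) (((∑ i, z i • T i) ^ (k + 1)) w) =
      z i • (binCoeff m k : ℂ) • ((∑ i, z i • T i) ^ k) w := by
  rw [← map_smul, ← hid.pow_apply hm hreg hw, ← hid.pow_apply hm hreg hw,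
    adjoint_apply_pow_succ hreg z k i hw]

theorem DefectIdentity.defectOp_tuplePow_apply (hm : 1 ≤ m) (hcomm : ∀ i j, Commute (T i) (T j))
    (hreg : RegularAtZero T) (hid : DefectIdentity m T hreg.isClosed_range) {w : H}
    (hw : w ∈ wandering T) (α : Fin n → ℕ) :
    (binCoeff m (∑ i, α i) : ℂ) • defectOp m T (tuplePow T α w) =
      (binCoeff m (∑ i, α i + 1) : ℂ) • tuplePow T α w := by
  rw [← sub_eq_zero]
  have h := eq_zero_of_forall_sum_monomial_smul (k := ∑ i, α i)
    -- The multinomial factor is the one from expanding `(∑ z_i T_i)^k`; being nonzero, it is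
    -- cancelled at the end.
    (v := fun β => (Nat.multinomial univ β : ℂ) •
      ((binCoeff m (∑ i, α i) : ℂ) • defectOp m T (tuplePow T β w) -
        (binCoeff m (∑ i, α i + 1) : ℂ) • tuplePow T β w)) (fun z => ?_) (α := α) rfl
  · refine (smul_eq_zero.mp h).resolve_left ?_
    exact_mod_cast (Nat.multinomial_pos _ _).ne'
  · have h := hid.defectOp_pow_apply hm hreg hw z (∑ i, α i)
    rw [← sub_eq_zero, sum_smul_pow hcomm, _root_.sum_apply, map_sum, smul_sum, smul_sum,
      ← sum_sub_distrib] at h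
    rw [← h]
    refine sum_congr rfl fun β _ => ?_
    rw [smul_apply, map_smul]
    module

/-! ### Passage to single monomials. -/

theorem exists_eq_add_single {α : Fin n → ℕ} {i : Fin n} (hi : α i ≠ 0) :
    ∃ β : Fin n → ℕ, α = β + Pi.single i 1 := by
  refine ⟨α - Pi.single i 1, (tsub_add_cancel_of_le fun j => ?_).symm⟩
  rcases eq_or_ne j i with rfl | hj
  · simpa using Nat.one_le_iff_ne_zero.mpr hi
  · simp [hj]

/-- Adding `1` in place `i` maps the indices of degree `k` bijectively onto those of degree `k + 1`
with `α i ≠ 0`; `g` vanishes on the others. -/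
theorem sum_piAntidiag_succ {E : Type*} [AddCommMonoid E] (k : ℕ) (i : Fin n)
    (f g : (Fin n → ℕ) → E) (h0 : ∀ α, α i = 0 → g α = 0)
    (h : ∀ α, g (α + Pi.single i 1) = f α) :
    ∑ α ∈ piAntidiag univ (k + 1), g α = ∑ α ∈ piAntidiag univ k, f α := by
  symm
  refine sum_of_injOn (fun α => α + Pi.single i 1) (add_left_injective _).injOn ?_ ?_
    fun α _ => (h α).symm
  · intro α hα
    simpa [sum_add_distrib] using hα
  · intro α hα hα'
    refine h0 α ?_
    by_contra hi
    obtain ⟨β, rfl⟩ := exists_eq_add_single hi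
    refine hα' ⟨β, ?_, rfl⟩
    simpa [sum_add_distrib] using hα

section Shift

variable (hm : 1 ≤ m) (hcomm : ∀ i j, Commute (T i) (T j)) (hreg : RegularAtZero T)
  (hid : DefectIdentity m T hreg.isClosed_range)

include hm hcomm hid

/-- Coefficient comparison in `DefectIdentity.adjoint_pow_apply`. The function `g` stands for the
shifted right-hand side, described by its two properties so that the cases `α i = 0` and `α i ≠ 0`
are handled together. -/
theorem DefectIdentity.adjoint_tuplePow_apply_aux {w : H} (hw : w ∈ wandering T) (i : Fin n)
    {g : (Fin n → ℕ) → H} (h0 : ∀ α, α i = 0 → g α = 0)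
    (h : ∀ α, g (α + Pi.single i 1) = (kernelWeight m α : ℂ) • tuplePow T α w) (α : Fin n → ℕ) :
    (kernelWeight m α : ℂ) • adjoint (T i) (tuplePow T α w) = g α := by
  -- The identity being compared starts in degree `1`; in degree `0` the claim is `T_i* w = 0`.
  rcases eq_or_ne (∑ j, α j) 0 with hα | hα
  · obtain rfl : α = 0 := by
      ext j
      exact (sum_eq_zero_iff.mp hα) j (mem_univ j)
    rw [h0 0 rfl, tuplePow_zero, one_apply_eq_self, adjoint_apply_of_mem_wandering hw, smul_zero]
  obtain ⟨k, hk⟩ := Nat.exists_eq_succ_of_ne_zero hα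
  rw [← sub_eq_zero]
  refine eq_zero_of_forall_sum_monomial_smul (k := k + 1)
    (v := fun α => (kernelWeight m α : ℂ) • adjoint (T i) (tuplePow T α w) - g α) (fun z => ?_) hk
  have h1 := hid.adjoint_pow_apply hm hreg hw z k i
  rw [← map_smul, binCoeff_smul_pow_apply hcomm, binCoeff_smul_pow_apply hcomm, map_sum,
    smul_sum] at h1
  rw [← sum_piAntidiag_succ k i _ (fun α => (∏ j, z j ^ α j) • g α)] at h1
  · simp only [smul_sub, sum_sub_distrib]
    rw [sub_eq_zero, ← h1]
    simp only [map_smul]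
  · intro α hα
    simp only [h0 α hα, smul_zero]
  · intro α
    simp only [h, prod_pow_add_single, mul_smul]

theorem DefectIdentity.adjoint_tuplePow_apply_of_eq_zero {w : H} (hw : w ∈ wandering T)
    {i : Fin n} {α : Fin n → ℕ} (hα : α i = 0) : adjoint (T i) (tuplePow T α w) = 0 := by
  have h := hid.adjoint_tuplePow_apply_aux hm hcomm hreg hw i
    (g := fun α => if α i = 0 then 0 else
      (kernelWeight m (α - Pi.single i 1) : ℂ) • tuplePow T (α - Pi.single i 1) w)
    (fun α hα => if_pos hα) (fun α => by simp) α
  rw [if_pos hα] at h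
  refine (smul_eq_zero.mp h).resolve_left ?_
  exact_mod_cast (kernelWeight_pos m α).ne'

theorem DefectIdentity.adjoint_tuplePow_add_single_apply {w : H} (hw : w ∈ wandering T)
    (i : Fin n) (α : Fin n → ℕ) :
    (kernelWeight m (α + Pi.single i 1) : ℂ) • adjoint (T i) (tuplePow T (α + Pi.single i 1) w) =
      (kernelWeight m α : ℂ) • tuplePow T α w := by
  have h := hid.adjoint_tuplePow_apply_aux hm hcomm hreg hw i
    (g := fun α => if α i = 0 then 0 else
      (kernelWeight m (α - Pi.single i 1) : ℂ) • tuplePow T (α - Pi.single i 1) w)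
    (fun α hα => if_pos hα) (fun α => by simp) (α + Pi.single i 1)
  simpa using h

/-- Induction on `|β|`: a factor `T_i` of `T^β` moves across as `T_i*`, which lowers `α` by one in
place `i` and turns its weight into that of the lowered index, or gives `0` if `α i = 0`. At `β = 0`
the wandering subspace is orthogonal to every range `T_i H`. -/
theorem DefectIdentity.inner_tuplePow_apply {w w' : H} (hw : w ∈ wandering T)
    (hw' : w' ∈ wandering T) (α β : Fin n → ℕ) :
    (kernelWeight m α : ℂ) * inner ℂ (tuplePow T β w') (tuplePow T α w) =
      if α = β then inner ℂ w' w else 0 := by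
  obtain ⟨d, hd⟩ : ∃ d, ∑ i, β i = d := ⟨_, rfl⟩
  induction d generalizing α β with
  | zero =>
    obtain rfl : β = 0 := by
      ext j
      exact (sum_eq_zero_iff.mp hd) j (mem_univ j)
    split_ifs with hα
    · rw [hα, kernelWeight_zero, tuplePow_zero]
      simp
    · obtain ⟨i, hi⟩ := Function.ne_iff.mp hα
      obtain ⟨γ, rfl⟩ := exists_eq_add_single hi
      rw [tuplePow_add_single hcomm, tuplePow_zero, mul_apply_eq_comp, one_apply_eq_self,
        Submodule.inner_left_of_mem_orthogonal (apply_mem_range_rowOp T i _) hw', mul_zero]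
  | succ d ih =>
    obtain ⟨i, hi⟩ : ∃ i, β i ≠ 0 := by
      by_contra! h
      simp [h] at hd
    obtain ⟨β, rfl⟩ := exists_eq_add_single hi
    rw [tuplePow_add_single hcomm, mul_apply_eq_comp, ← ContinuousLinearMap.adjoint_inner_right]
    by_cases hα : α i = 0
    · rw [hid.adjoint_tuplePow_apply_of_eq_zero hm hcomm hreg hw hα, inner_zero_right, mul_zero,
        if_neg]
      rintro rfl
      exact hi hα
    · obtain ⟨α, rfl⟩ := exists_eq_add_single hα
      rw [← inner_smul_right, hid.adjoint_tuplePow_add_single_apply hm hcomm hreg hw,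
        inner_smul_right, ih α β (by simpa [sum_add_distrib] using hd)]
      simp only [add_left_inj]

/-- The isometry `w ↦ ‖T^α w‖⁻¹ ‖w‖ T^α w` on the wandering subspace. -/
def DefectIdentity.monomialIsometry (α : Fin n → ℕ) : wandering T →ₗᵢ[ℂ] H where
  toLinearMap := ((Real.sqrt (kernelWeight m α) : ℂ) • tuplePow T α : H →L[ℂ] H).toLinearMap ∘ₗ
    (wandering T).subtype
  norm_map' w := by
    have h := hid.inner_tuplePow_apply hm hcomm hreg w.2 w.2 α α
    rw [if_pos rfl, inner_self_eq_norm_sq_to_K, inner_self_eq_norm_sq_to_K] at h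
    change ‖(Real.sqrt (kernelWeight m α) : ℂ) • tuplePow T α w‖ = ‖(w : H)‖
    rw [← sq_eq_sq₀ (norm_nonneg _) (norm_nonneg _), norm_smul, mul_pow, Complex.norm_real,
      Real.norm_of_nonneg (Real.sqrt_nonneg _), Real.sq_sqrt (Nat.cast_nonneg _)]
    exact Complex.ofReal_injective (by simpa using h)

theorem DefectIdentity.monomialIsometry_apply (α : Fin n → ℕ) (w : wandering T) :
    hid.monomialIsometry hm hcomm hreg α w =
      (Real.sqrt (kernelWeight m α) : ℂ) • tuplePow T α w := rfl

theorem DefectIdentity.orthogonalFamily :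
    OrthogonalFamily ℂ (fun _ : Fin n → ℕ => wandering T)
      (hid.monomialIsometry hm hcomm hreg) := by
  intro β α hne w' w
  have h := hid.inner_tuplePow_apply hm hcomm hreg w.2 w'.2 α β
  rw [if_neg hne.symm] at h
  have h1 : inner ℂ (tuplePow T β w') (tuplePow T α w) = 0 :=
    (mul_eq_zero.mp h).resolve_left (by exact_mod_cast (kernelWeight_pos m α).ne')
  rw [hid.monomialIsometry_apply, hid.monomialIsometry_apply, inner_smul_left, inner_smul_right,
    h1, mul_zero, mul_zero]

/-! ### Adjoints of the monomials in the `L_i`. -/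

theorem DefectIdentity.adjoint_compL_tuplePow_apply {w : H} (hw : w ∈ wandering T) (i : Fin n)
    (β : Fin n → ℕ) :
    (binCoeff m (∑ j, β j) : ℂ) • adjoint (compL T hreg.isClosed_range i) (tuplePow T β w) =
      (binCoeff m (∑ j, β j + 1) : ℂ) • tuplePow T (β + Pi.single i 1) w := by
  rw [hid.adjoint_compL, mul_apply_eq_comp, ← map_smul,
    hid.defectOp_tuplePow_apply hm hcomm hreg hw, map_smul, tuplePow_add_single hcomm]
  rfl

/-- Each `L_i*` acts on the vectors `T^β w` as a forward shift with factor `b_(|β|+1) / b_|β|`,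
which depends on the degree only. The factors telescope along the ordered product, so commutativity
of the `L_i` is not needed. -/
theorem DefectIdentity.adjoint_tuplePow_compL_apply {w : H} (hw : w ∈ wandering T)
    (α : Fin n → ℕ) :
    adjoint (tuplePow (compL T hreg.isClosed_range) α) w =
      (binCoeff m (∑ j, α j) : ℂ) • tuplePow T α w := by
  have h1 : ∀ i k (β : Fin n → ℕ), (binCoeff m (∑ j, β j) : ℂ) •
      adjoint (compL T hreg.isClosed_range i ^ k) (tuplePow T β w) =
      (binCoeff m (∑ j, (β + Pi.single i k : Fin n → ℕ) j) : ℂ) • tuplePow T (β + Pi.single i k) w := by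
    intro i k
    induction k with
    | zero => simp [← ContinuousLinearMap.star_eq_adjoint]
    | succ k ih =>
      have h := comp_tuplePow_apply ih
        (S' := adjoint (compL T hreg.isClosed_range i)) (δ' := Pi.single i 1) fun β => by
          rw [hid.adjoint_compL_tuplePow_apply hm hcomm hreg hw]
          simp [sum_add_distrib]
      simp only [← ContinuousLinearMap.star_eq_adjoint, ← star_mul, ← pow_succ] at h ⊢
      simpa only [← Pi.single_add] using h
  -- Stated for lists of any length, decoupled from `n`, so that the ordered product can be built by
  -- induction; the adjoint of its leftmost factor acts first.
  have h2 : ∀ (r : ℕ) (S : Fin r → H →L[ℂ] H) (δ : Fin r → Fin n → ℕ),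
      (∀ l β, (binCoeff m (∑ j, β j) : ℂ) • adjoint (S l) (tuplePow T β w) =
        (binCoeff m (∑ j, (β + δ l) j) : ℂ) • tuplePow T (β + δ l) w) →
      ∀ β, (binCoeff m (∑ j, β j) : ℂ) • adjoint (List.ofFn S).prod (tuplePow T β w) =
        (binCoeff m (∑ j, (β + ∑ l, δ l) j) : ℂ) • tuplePow T (β + ∑ l, δ l) w := by
    intro r
    induction r with
    | zero => simp [← ContinuousLinearMap.star_eq_adjoint]
    | succ r ih =>
      intro S δ h
      have h3 := comp_tuplePow_apply (h 0) (ih (fun l => S l.succ) (fun l => δ l.succ)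
        fun l => h l.succ)
      rw [List.ofFn_succ, List.prod_cons, Fin.sum_univ_succ]
      simpa only [← ContinuousLinearMap.star_eq_adjoint, star_mul] using h3
  -- Starting index `0`, where `T^0 w = w` and `b_0 = 1`.
  have h3 := h2 n _ _ (fun i => h1 i (α i)) 0
  rw [zero_add, univ_sum_single, tuplePow_zero] at h3
  rw [tuplePow]
  simpa [binCoeff_zero] using h3

end Shift

end Defect

section Model

variable {H : Type*} [NormedAddCommGroup H] [InnerProductSpace ℂ H] {n m : ℕ}
  {T : Fin n → H →L[ℂ] H}

/-! ### The unitary equivalence -/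

theorem isClosed_invariantHull (T : Fin n → H →L[ℂ] H) (M : Set H) :
    IsClosed (invariantHull T M : Set H) := by
  rw [invariantHull, Submodule.coe_sInf]
  exact isClosed_biInter fun N hN => hN.1

theorem subset_invariantHull (T : Fin n → H →L[ℂ] H) (M : Set H) :
    M ⊆ invariantHull T M := by
  intro x hx
  simp only [invariantHull, SetLike.mem_coe, Submodule.mem_sInf]
  exact fun N hN => hN.2.2 hx

theorem invariantHull_le {T : Fin n → H →L[ℂ] H} {M : Set H} {N : Submodule ℂ H}
    (h1 : IsClosed (N : Set H)) (h2 : ∀ i, ∀ x ∈ N, T i x ∈ N) (h3 : M ⊆ N) :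
    invariantHull T M ≤ N :=
  sInf_le ⟨h1, h2, h3⟩

theorem tuplePow_apply_mem_invariantHull (hcomm : ∀ i j, Commute (T i) (T j)) {M : Set H} {x : H}
    (hx : x ∈ invariantHull T M) (α : Fin n → ℕ) : tuplePow T α x ∈ invariantHull T M := by
  obtain ⟨d, hd⟩ : ∃ d, ∑ i, α i = d := ⟨_, rfl⟩
  induction d generalizing α with
  | zero =>
    obtain rfl : α = 0 := by
      ext j
      exact (sum_eq_zero_iff.mp hd) j (mem_univ j)
    rwa [tuplePow_zero]
  | succ d ih =>
    obtain ⟨i, hi⟩ : ∃ i, α i ≠ 0 := by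
      by_contra! h
      simp [h] at hd
    obtain ⟨α, rfl⟩ := exists_eq_add_single hi
    rw [tuplePow_add_single hcomm]
    exact apply_mem_invariantHull T M i _ (ih α (by simpa [sum_add_distrib] using hd))

theorem sqrt_kernelWeight_ne_zero (m : ℕ) (α : Fin n → ℕ) :
    (Real.sqrt (kernelWeight m α) : ℂ) ≠ 0 := by
  rw [Complex.ofReal_ne_zero, Real.sqrt_ne_zero (Nat.cast_nonneg _)]
  exact_mod_cast (kernelWeight_pos m α).ne'

variable [CompleteSpace H] (hm : 1 ≤ m) (hcomm : ∀ i j, Commute (T i) (T j)) (hreg : RegularAtZero T)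
  (hid : DefectIdentity m T hreg.isClosed_range)

/-- The range is the closed span of all `T^α w`. It lies in the hull by invariance, and it is itself
closed, invariant and contains `W(T)` as the part with `α = 0`. -/
theorem DefectIdentity.range_linearIsometry :
    LinearMap.range (hid.orthogonalFamily hm hcomm hreg).linearIsometry.toLinearMap =
      invariantHull T (wandering T) := by
  have hmem : ∀ α (w : wandering T), tuplePow T α w ∈
      ⨆ α, LinearMap.range (hid.monomialIsometry hm hcomm hreg α).toLinearMap := by
    intro α w
    refine Submodule.mem_iSup_of_mem α ⟨(Real.sqrt (kernelWeight m α) : ℂ)⁻¹ • w, ?_⟩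
    change hid.monomialIsometry hm hcomm hreg α _ = _
    rw [map_smul, hid.monomialIsometry_apply, smul_smul,
      inv_mul_cancel₀ (sqrt_kernelWeight_ne_zero m α), one_smul]
  rw [OrthogonalFamily.range_linearIsometry]
  apply le_antisymm
  · refine Submodule.topologicalClosure_minimal _ (iSup_le fun α => ?_)
      (isClosed_invariantHull T _)
    rintro _ ⟨w, rfl⟩
    exact Submodule.smul_mem _ _ (tuplePow_apply_mem_invariantHull hcomm
      (subset_invariantHull T _ w.2) α)
  · refine invariantHull_le (Submodule.isClosed_topologicalClosure _) (fun i x hx => ?_)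
      fun w hw => ?_
    · have hle : (⨆ α, LinearMap.range (hid.monomialIsometry hm hcomm hreg α).toLinearMap) ≤
          Submodule.comap (T i : H →ₗ[ℂ] H) (⨆ α,
            LinearMap.range (hid.monomialIsometry hm hcomm hreg α).toLinearMap) := by
        refine iSup_le fun α => ?_
        rintro _ ⟨w, rfl⟩
        rw [Submodule.mem_comap]
        change T i ((Real.sqrt (kernelWeight m α) : ℂ) • tuplePow T α w) ∈
          ⨆ α, LinearMap.range (hid.monomialIsometry hm hcomm hreg α).toLinearMap
        rw [map_smul, ← mul_apply_eq_comp, ← tuplePow_add_single hcomm]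
        exact Submodule.smul_mem _ _ (hmem _ w)
      exact map_mem_closure (T i).continuous hx hle
    · refine Submodule.le_topologicalClosure _ ?_
      simpa [tuplePow_zero] using hmem 0 ⟨w, hw⟩

/-- The isometric isomorphism of the space of families of coefficients in the wandering subspace
with the invariant subspace which the wandering subspace generates. -/
def DefectIdentity.hullEquiv :
    CoeffSpace n (wandering T) ≃ₗᵢ[ℂ] invariantHull T (wandering T) :=
  (hid.orthogonalFamily hm hcomm hreg).linearIsometry.equivRange.trans
    (LinearIsometryEquiv.ofEq _ _ (hid.range_linearIsometry hm hcomm hreg))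

theorem DefectIdentity.coe_hullEquiv (a : CoeffSpace n (wandering T)) :
    (hid.hullEquiv hm hcomm hreg a : H) =
      (hid.orthogonalFamily hm hcomm hreg).linearIsometry a := rfl

theorem DefectIdentity.hullEquiv_single (α : Fin n → ℕ) (w : wandering T) :
    (hid.hullEquiv hm hcomm hreg (lp.single 2 α w) : H) =
      (Real.sqrt (kernelWeight m α) : ℂ) • tuplePow T α w := by
  rw [hid.coe_hullEquiv, OrthogonalFamily.linearIsometry_apply_single]
  rfl

/-- Pairing with `w ∈ W(T)` and moving `L^α` across yields `γ_α b_|α| ⟨T^α w, x⟩`. One square root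
of this weight normalizes `T^α w` and extracts `a α`; the other remains and becomes the
normalization of the monomial `z^α`. -/
theorem DefectIdentity.gammaCoeff_smul_projection (a : CoeffSpace n (wandering T))
    (α : Fin n → ℕ) :
    gammaCoeff α • (wandering T).orthogonalProjectionOnto
        (tuplePow (compL T hreg.isClosed_range) α (hid.hullEquiv hm hcomm hreg a)) =
      (Real.sqrt (kernelWeight m α) : ℂ) • a α := by
  refine ext_inner_left ℂ fun w => ?_
  have h1 : inner ℂ (hid.hullEquiv hm hcomm hreg (lp.single 2 α w) : H)
      (hid.hullEquiv hm hcomm hreg a : H) = inner ℂ w (a α) := by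
    rw [← Submodule.coe_inner, LinearIsometryEquiv.inner_map_map, lp.inner_single_left]
  rw [hid.hullEquiv_single, inner_smul_left, Complex.conj_ofReal] at h1
  have h2 : (Real.sqrt (kernelWeight m α) : ℂ) * (Real.sqrt (kernelWeight m α) : ℂ) =
      Nat.multinomial univ α * binCoeff m (∑ i, α i) := by
    rw [← Complex.ofReal_mul, Real.mul_self_sqrt (Nat.cast_nonneg _), Complex.ofReal_natCast,
      kernelWeight, Nat.cast_mul]
  rw [inner_smul_right, inner_smul_right, gammaCoeff_eq_multinomial,
    Submodule.inner_orthogonalProjectionOnto_eq_of_mem_left,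
    ← ContinuousLinearMap.adjoint_inner_left, hid.adjoint_tuplePow_compL_apply hm hcomm hreg w.2,
    inner_smul_left, ← h1, Complex.conj_natCast]
  linear_combination -(inner ℂ (tuplePow T α w) (hid.hullEquiv hm hcomm hreg a : H)) * h2

/-- The unitary operator from `[W(T)]` onto `H_m(𝔹, W(T))`. -/
def DefectIdentity.modelEquiv :
    invariantHull T (wandering T) ≃ₗᵢ[ℂ] HSpace n m (wandering T) :=
  (hid.hullEquiv hm hcomm hreg).symm.trans (coeffEquiv hm).symm

theorem DefectIdentity.hasSum_modelEquiv (x : invariantHull T (wandering T)) (z : UnitBall n) :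
    HasSum (fun α : Fin n → ℕ => (∏ i, z.1 i ^ α i) • gammaCoeff α •
        (wandering T).orthogonalProjectionOnto (tuplePow (compL T hreg.isClosed_range) α x))
      (hid.modelEquiv hm hcomm hreg x z) := by
  obtain ⟨a, rfl⟩ := (hid.hullEquiv hm hcomm hreg).surjective x
  refine ((hasSum_coeffEquiv_symm hm a z).congr_fun fun α => ?_ : HasSum _ _).trans_eq ?_
  · rw [hid.gammaCoeff_smul_projection hm hcomm hreg, smul_smul, normMonomial, mul_comm]
  · simp [modelEquiv]

/-! ### Intertwining with the coordinate multiplications. -/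

theorem coeffEquiv_symm_single {E : Type*} [NormedAddCommGroup E] [InnerProductSpace ℂ E]
    [CompleteSpace E] (hm : 1 ≤ m) (α : Fin n → ℕ) (e : E) (z : UnitBall n) :
    (coeffEquiv hm).symm (lp.single 2 α e) z = normMonomial m z α • e := by
  refine (hasSum_coeffEquiv_symm hm _ z).unique ?_
  convert hasSum_single α fun β hβ => ?_ using 1
  · simp
  · simp [lp.single_apply, hβ]

theorem DefectIdentity.restrictHull_hullEquiv_single (i : Fin n) (α : Fin n → ℕ)
    (w : wandering T) :
    restrictHull T (wandering T) i (hid.hullEquiv hm hcomm hreg (lp.single 2 α w)) =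
      hid.hullEquiv hm hcomm hreg (lp.single 2 (α + Pi.single i 1)
        (((Real.sqrt (kernelWeight m α) : ℂ) /
          Real.sqrt (kernelWeight m (α + Pi.single i 1))) • w)) := by
  apply Subtype.ext
  change T i (hid.hullEquiv hm hcomm hreg (lp.single 2 α w) : H) = _
  rw [hid.hullEquiv_single, hid.hullEquiv_single, map_smul, tuplePow_add_single hcomm,
    Submodule.coe_smul, map_smul, smul_smul,
    mul_div_cancel₀ _ (sqrt_kernelWeight_ne_zero m (α + Pi.single i 1))]
  rfl

/-- In coefficients `T_i` is a weighted shift, and multiplication by `z_i` shifts the normalized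
monomials with the same weights. -/
theorem DefectIdentity.modelEquiv_restrictHull (i : Fin n)
    (x : invariantHull T (wandering T)) :
    hid.modelEquiv hm hcomm hreg (restrictHull T (wandering T) i x) =
      mulCoord n m (wandering T) i (hid.modelEquiv hm hcomm hreg x) := by
  obtain ⟨a, rfl⟩ := (hid.hullEquiv hm hcomm hreg).surjective x
  let e : CoeffSpace n (wandering T) →L[ℂ] invariantHull T (wandering T) :=
    (hid.hullEquiv hm hcomm hreg).toContinuousLinearEquiv
  let u : invariantHull T (wandering T) →L[ℂ] HSpace n m (wandering T) :=
    (hid.modelEquiv hm hcomm hreg).toContinuousLinearEquiv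
  suffices h : u ∘L restrictHull T (wandering T) i ∘L e =
      mulCoord n m (wandering T) i ∘L u ∘L e from congrArg (fun R => R a) h
  -- Both sides are continuous in the coefficient family, so families supported at one index
  -- suffice.
  refine lp.ext_continuousLinearMap (by simp) fun α => ?_
  ext w : 1
  refine RKHS.ext fun z => ?_
  change hid.modelEquiv hm hcomm hreg (restrictHull T (wandering T) i
      (hid.hullEquiv hm hcomm hreg (lp.single 2 α w))) z =
    mulCoord n m (wandering T) i (hid.modelEquiv hm hcomm hreg
      (hid.hullEquiv hm hcomm hreg (lp.single 2 α w))) z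
  rw [mulCoord_apply hm, hid.restrictHull_hullEquiv_single]
  simp only [modelEquiv, LinearIsometryEquiv.trans_apply, LinearIsometryEquiv.symm_apply_apply,
    coeffEquiv_symm_single, smul_smul]
  congr 1
  have hne := sqrt_kernelWeight_ne_zero m (α + Pi.single i 1)
  rw [normMonomial, normMonomial, prod_pow_add_single]
  field_simp

end Model

end BergmanShift

end

theorem mainTheorem3 {H : Type*} [NormedAddCommGroup H] [InnerProductSpace ℂ H] [CompleteSpace H]
    (n m : ℕ) (hm : 1 ≤ m) (T : Fin n → H →L[ℂ] H)
    (hcomm : ∀ i j, Commute (T i) (T j))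
    (hreg : BergmanShift.RegularAtZero T)
    (hid : ∀ y : (ContinuousLinearMap.adjoint (BergmanShift.rowOp T)).range,
      (BergmanShift.gramInv (BergmanShift.rowOp T) hreg.isClosed_range y :
          BergmanShift.HPow n H) =
        BergmanShift.diagOp n (BergmanShift.defectOp m T) (y : BergmanShift.HPow n H)) :
    ∃ U : BergmanShift.invariantHull T (BergmanShift.wandering T) ≃ₗᵢ[ℂ]
        BergmanShift.HSpace n m (BergmanShift.wandering T),
      (∀ (x : BergmanShift.invariantHull T (BergmanShift.wandering T))
          (z : BergmanShift.UnitBall n),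
        HasSum (fun α : Fin n → ℕ =>
          (∏ i, z.1 i ^ α i) • BergmanShift.gammaCoeff α •
            (BergmanShift.wandering T).orthogonalProjectionOnto
              (BergmanShift.tuplePow (BergmanShift.compL T hreg.isClosed_range) α x))
          (U x z)) ∧
      ∀ (i : Fin n) (x : BergmanShift.invariantHull T (BergmanShift.wandering T)),
        U (BergmanShift.restrictHull T (BergmanShift.wandering T) i x) =
          BergmanShift.mulCoord n m (BergmanShift.wandering T) i (U x) := by
  have hid' : BergmanShift.DefectIdentity m T hreg.isClosed_range := hid
  exact ⟨hid'.modelEquiv hm hcomm hreg, hid'.hasSum_modelEquiv hm hcomm hreg,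
    hid'.modelEquiv_restrictHull hm hcomm hreg⟩
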